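/- Notation. Let $\mathrm{Im}\,\omega>0$ and let $\theta_1,\dots,\theta_4$ be the Jacobi theta functions with nome $q=e^{i\pi t}$, e.g. $\theta_1(u|t)=2\sum_{n\ge0}(-1)^nq^{(n+1/2)^2}\sin((2n+1)u)$, $\theta_4(u|t)=\sum_{n\in\mathbb Z}(-1)^nq^{n^2}e^{2inu}$. Put $\theta(\lambda)=\theta_1(\lambda|\omega)$, and write $\theta_j(u)$ for $\theta_j(u|2\omega)$, $j=1,\dots,4$. Let $\mathsf N\ge0$ and let $\eta,\alpha,\zeta,\kappa,\tau,\xi_1,\dots,\xi_{\mathsf N}$ be complex numbers with $\theta_1(\zeta)\ne0$. Let $$R(\lambda)=\begin{pmatrix}\mathrm a&0&0&\mathrm d\\0&\mathrm b&\mathrm c&0\\0&\mathrm c&\mathrm b&0\\\mathrm d&0&0&\mathrm a\end{pmatrix}(\lambda)$$ be the eight-vertex $R$-matrix, where, with $c_0=2/(\theta_2(0|\omega)\theta_4(0))$, $\mathrm a(\lambda)=c_0\theta_4(\eta)\theta_1(\lambda+\eta)\theta_4(\lambda)$, $\mathrm b(\lambda)=c_0\theta_4(\eta)\theta_1(\lambda)\theta_4(\lambda+\eta)$,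 $\mathrm c(\lambda)=c_0\theta_1(\eta)\theta_4(\lambda)\theta_4(\lambda+\eta)$, $\mathrm d(\lambda)=c_0\theta_1(\eta)\theta_1(\lambda+\eta)\theta_1(\lambda)$. On $\mathbb C^2\otimes(\mathbb C^2)^{\otimes\mathsf N}$ (auxiliary space $0$ and sites $1,\dots,\mathsf N$) put $$M(\lambda)=R_{0\mathsf N}(\lambda-\xi_{\mathsf N}-\eta/2)\cdots R_{01}(\lambda-\xi_1-\eta/2),\qquad \hat M(\lambda)=(-1)^{\mathsf N}\sigma_0^yM(-\lambda)^{t_0}\sigma_0^y,$$ $$\mathcal U_-(\lambda)=\begin{pmatrix}\mathcal A_-(\lambda)&\mathcal B_-(\lambda)\\\mathcal C_-(\lambda)&\mathcal D_-(\lambda)\end{pmatrix}=M(\lambda)K_-(\lambda)\hat M(\lambda),\qquad K_-(\lambda)=K(\lambda-\eta/2),$$ where $K_{11}(\lambda)=\frac{\theta_4(\zeta)\theta_4(\zeta-\lambda)\theta_1(\zeta+\lambda)}{\theta_1(\zeta)}$, $K_{22}(\lambda)=K_{11}(-\lambda)$, $K_{12}(\lambda)=\frac{\kappa e^{\tau}\theta_1(2\lambda)(\theta_4(\lambda)^2-e^{-2\tau}\theta_1(\lambda)^2)\theta_4(\zeta)^3}{\theta_1(\zeta)\theta_4(0)^2\theta_4(2\lambda)}$,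 and $K_{21}$ is $K_{12}$ with $\tau$ replaced by $-\tau$. Put $p(\lambda)=2\theta_4(2\lambda+\eta)\theta_1(2\lambda-\eta)/\theta_2(0|\omega)$, $$\mathrm{det}_q\,\mathcal U_-(\lambda)=p(\lambda-\tfrac\eta2)\left[\mathcal A_-(\lambda+\tfrac\eta2)\mathcal A_-(\tfrac\eta2-\lambda)+\mathcal B_-(\lambda+\tfrac\eta2)\mathcal C_-(\tfrac\eta2-\lambda)\right],$$ and $\widetilde{\mathcal U}_-(\lambda)=-\theta(\eta)^{-1}\,\mathrm{tr}_2\big(R_{12}(-\eta)(\mathcal U_-)_2(\lambda)R_{21}(2\lambda)\big)$, where $1,2$ are two copies of the auxiliary space. Gauge transformation. For $\beta\in\mathbb C$ put $X_\beta(\lambda)=\binom{\theta_2(\lambda+(\alpha+\beta)\eta)}{\theta_3(\lambda+(\alpha+\beta)\eta)}$, $Y_\beta=X_{-\beta}$, $\tilde G(\lambda|\beta)=(X_{\beta+1}(\lambda),Y_{\beta-1}(\lambda))$; its inverse $\tilde G^{-1}(\lambda|\beta)$ has the rows $\frac{(-\theta_3(y),\ \theta_2(y))}{\theta(\lambda+(\alpha+1)\eta)\theta(\beta\eta)}$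 and $\frac{(\theta_3(x),\ -\theta_2(x))}{\theta(\lambda+(\alpha+1)\eta)\theta(\beta\eta)}$ with $x=\lambda+(\alpha+\beta+1)\eta$, $y=\lambda+(\alpha-\beta+1)\eta$. Define $$\mathsf U_-(\lambda|\beta)=\begin{pmatrix}\widehat{\mathcal A}_-(\lambda|\beta+2)&\widehat{\mathcal B}_-(\lambda|\beta)\\\widehat{\mathcal C}_-(\lambda|\beta+2)&\widehat{\mathcal D}_-(\lambda|\beta)\end{pmatrix}=\tilde G^{-1}(\lambda-\tfrac\eta2|\beta)\,\mathcal U_-(\lambda)\,\tilde G(\tfrac\eta2-\lambda|\beta),$$ $\tilde{\mathsf U}_-(\lambda|\beta)=\tilde G^{-1}(-\lambda-\tfrac\eta2|\beta)\,\widetilde{\mathcal U}_-(\lambda)\,\tilde G(\tfrac\eta2+\lambda|\beta)$, $r(\lambda)=\theta_4(2\lambda-\eta)\,\theta(\lambda+(\alpha+\tfrac12)\eta)$, and the rescaled generators $\mathcal A_-(\lambda|\beta)=r(\lambda)\widehat{\mathcal A}_-(\lambda|\beta)$, and likewise $\mathcal B_-,\mathcal C_-,\mathcal D_-$. Proposition.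 For all $\lambda,\beta\in\mathbb C$ for which the denominators occurring in the definition of the two sides do not vanish, the following hold. (1) Interrelated parity relations: $$\mathcal A_-(\lambda|\beta)=-\frac{\theta(\eta)\theta(2\lambda-(\beta-1)\eta)}{\theta(2\lambda)\theta((\beta-2)\eta)}\mathcal D_-(\lambda|\beta)+\frac{\theta(2\lambda-\eta)\theta((\beta-1)\eta)}{\theta(2\lambda)\theta((\beta-2)\eta)}\mathcal D_-(-\lambda|\beta),$$ $$\mathcal D_-(\lambda|\beta)=\frac{\theta(\eta)\theta(2\lambda+(\beta-1)\eta)}{\theta(2\lambda)\theta(\beta\eta)}\mathcal A_-(\lambda|\beta)+\frac{\theta(2\lambda-\eta)\theta((\beta-1)\eta)}{\theta(2\lambda)\theta(\beta\eta)}\mathcal A_-(-\lambda|\beta).$$ (2) Independent parity relations: $$\mathcal B_-(-\lambda|\beta)=-\frac{\theta(2\lambda+\eta)}{\theta(2\lambda-\eta)}\mathcal B_-(\lambda|\beta),\qquad \mathcal C_-(-\lambda|\beta)=-\frac{\theta(2\lambda+\eta)}{\theta(2\lambda-\eta)}\mathcal C_-(\lambda|\beta).$$ (3) $\det_q\mathcal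 U_-(\lambda)$ is a scalar multiple of the identity, with value $\det_qK_-(\lambda)\,m(\lambda)\,m(-\lambda)$, where $\det_qK_-(\lambda)=p(\lambda-\frac\eta2)\big[(K_-(\lambda+\frac\eta2))_{11}(K_-(\frac\eta2-\lambda))_{11}+(K_-(\lambda+\frac\eta2))_{12}(K_-(\frac\eta2-\lambda))_{21}\big]$, $m(\lambda)=a(\lambda+\frac\eta2)a(\lambda-\frac{3\eta}2)$, $a(\lambda)=\prod_{n=1}^{\mathsf N}\theta(\lambda-\xi_n+\frac\eta2)$. One has $\tilde{\mathsf U}_-(\lambda-\frac\eta2|\beta)=p(\lambda-\frac\eta2)\,\mathsf U_-(\frac\eta2-\lambda|\beta)$; the product of $\mathsf U_-(\lambda+\frac\eta2|\beta)$ with $p(\lambda-\frac\eta2)\,\mathsf U_-(\frac\eta2-\lambda|\beta)$, in either order, is $\det_q\mathcal U_-(\lambda)$; and if $\det_q\mathcal U_-(\lambda)\neq0$, then $\mathsf U_-(\lambda+\frac\eta2|\beta)$ is invertible and $$\mathsf U_-^{-1}(\lambda+\tfrac\eta2|\beta)=\frac{\tilde{\mathsf U}_-(\lambda-\frac\eta2|\beta)}{\det_q\mathcal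 U_-(\lambda)}=\frac{p(\lambda-\frac\eta2)}{\det_q\mathcal U_-(\lambda)}\,\mathsf U_-(\tfrac\eta2-\lambda|\beta).$$ (4) For both $\epsilon=\pm1$, $$\frac{\det_q\mathcal U_-(\lambda)\,r(\lambda+\frac\eta2)\,r(-\lambda+\frac\eta2)}{p(\lambda-\frac\eta2)}=\mathcal A_-(\epsilon\lambda+\tfrac\eta2|\beta+2)\mathcal A_-(\tfrac\eta2-\epsilon\lambda|\beta+2)+\mathcal B_-(\epsilon\lambda+\tfrac\eta2|\beta)\mathcal C_-(\tfrac\eta2-\epsilon\lambda|\beta+2)$$ $$=\mathcal D_-(\epsilon\lambda+\tfrac\eta2|\beta)\mathcal D_-(\tfrac\eta2-\epsilon\lambda|\beta)+\mathcal C_-(\epsilon\lambda+\tfrac\eta2|\beta+2)\mathcal B_-(\tfrac\eta2-\epsilon\lambda|\beta).$$ -/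

import Mathlib

open scoped Matrix Kronecker

noncomputable section

namespace EightVertex

/-! ### Theta functions, with nome `q = exp (π i t)`

In terms of `jacobiTheta₂ z t = ∑ n : ℤ, exp (2 π i n z + π i n² t)`. -/

/-- `θ₁(u|t) = -i ∑ n : ℤ, (-1)^n q^((n+1/2)²) e^((2n+1) i u)`
`= 2 ∑ n ≥ 0, (-1)^n q^((n+1/2)²) sin ((2n+1) u)`. -/
def theta1 (u t : ℂ) : ℂ :=
  -Complex.I * Complex.exp (Real.pi * Complex.I * t / 4 + Complex.I * u) *
    jacobiTheta₂ (u / Real.pi + t / 2 + 1 / 2) t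

/-- `θ₂(u|t) = ∑ n : ℤ, q^((n+1/2)²) e^((2n+1) i u)`
`= 2 ∑ n ≥ 0, q^((n+1/2)²) cos ((2n+1) u)`. -/
def theta2 (u t : ℂ) : ℂ :=
  Complex.exp (Real.pi * Complex.I * t / 4 + Complex.I * u) *
    jacobiTheta₂ (u / Real.pi + t / 2) t

/-- `θ₃(u|t) = ∑ n : ℤ, q^(n²) e^(2 n i u)`. -/
def theta3 (u t : ℂ) : ℂ := jacobiTheta₂ (u / Real.pi) t

/-- `θ₄(u|t) = ∑ n : ℤ, (-1)^n q^(n²) e^(2 n i u)`. -/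
def theta4 (u t : ℂ) : ℂ := jacobiTheta₂ (u / Real.pi + 1 / 2) t

/-! ### The chain with `N` sites -/

/-- The parameters: half period `ω`, crossing parameter `η`, gauge parameter `α`, the boundary
parameters `ζ₋, κ₋, τ₋`, and the inhomogeneities `ξ₁, …, ξ_N`. -/
structure Params (N : ℕ) where
  (ω η α ζ κ τ : ℂ)
  (ξ : Fin N → ℂ)

/-- `End (ℂ² ⊗ ⋯ ⊗ ℂ²)` (`N` factors), as matrices in the product basis. -/
abbrev Op (N : ℕ) : Type := Matrix (Fin N → Fin 2) (Fin N → Fin 2) ℂ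

/-- `End (R₀ ⊗ R_N)`: two-by-two matrices, indexed by the auxiliary space `R₀ = ℂ²`, whose
entries are operators on the chain. -/
abbrev AuxOp (N : ℕ) : Type := Matrix (Fin 2) (Fin 2) (Op N)

/-- A matrix of numbers regarded as a matrix of scalar operators. -/
def scalarMat {N : ℕ} {m n : Type*} (A : Matrix m n ℂ) : Matrix m n (Op N) :=
  A.map (algebraMap ℂ (Op N))

/-- The operator `X` on `ℂ²` acting on the site `n` of the chain. -/
def siteOp {N : ℕ} (n : Fin N) (X : Matrix (Fin 2) (Fin 2) ℂ) : Op N :=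
  Matrix.of fun s t => if ∀ m, m ≠ n → s m = t m then X (s n) (t n) else 0

variable {N : ℕ} (P : Params N)

/-- `θ(x) = θ₁(x|ω)`. -/
def th (x : ℂ) : ℂ := theta1 x P.ω

def coefA (x : ℂ) : ℂ :=
  2 * theta4 P.η (2 * P.ω) * theta1 (x + P.η) (2 * P.ω) * theta4 x (2 * P.ω) /
    (theta2 0 P.ω * theta4 0 (2 * P.ω))

def coefB (x : ℂ) : ℂ :=
  2 * theta4 P.η (2 * P.ω) * theta1 x (2 * P.ω) * theta4 (x + P.η) (2 * P.ω) /
    (theta2 0 P.ω * theta4 0 (2 * P.ω))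

def coefC (x : ℂ) : ℂ :=
  2 * theta1 P.η (2 * P.ω) * theta4 x (2 * P.ω) * theta4 (x + P.η) (2 * P.ω) /
    (theta2 0 P.ω * theta4 0 (2 * P.ω))

def coefD (x : ℂ) : ℂ :=
  2 * theta1 P.η (2 * P.ω) * theta1 (x + P.η) (2 * P.ω) * theta1 x (2 * P.ω) /
    (theta2 0 P.ω * theta4 0 (2 * P.ω))

/-- The eight-vertex `R`-matrix, in the ordered basis `(0,0), (0,1), (1,0), (1,1)` of
`ℂ² ⊗ ℂ²`. -/
def R8V (x : ℂ) : Matrix (Fin 2 × Fin 2) (Fin 2 × Fin 2) ℂ :=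
  Matrix.submatrix
    !![coefA P x, 0, 0, coefD P x;
       0, coefB P x, coefC P x, 0;
       0, coefC P x, coefB P x, 0;
       coefD P x, 0, 0, coefA P x]
    (finProdFinEquiv (m := 2) (n := 2)) (finProdFinEquiv (m := 2) (n := 2))

/-- `R₂₁ = Π R₁₂ Π` with the flip `Π` of the two factors. -/
def R8V21 (x : ℂ) : Matrix (Fin 2 × Fin 2) (Fin 2 × Fin 2) ℂ :=
  (R8V P x).submatrix Prod.swap Prod.swap

/-- `R₀ₙ(x)`, acting on the auxiliary space and on the site `n`. -/
def RSite (n : Fin N) (x : ℂ) : AuxOp N :=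
  Matrix.of fun i k => siteOp n (Matrix.of fun j l => R8V P x (i, j) (k, l))

/-- The bulk monodromy matrix
`M₀(x) = R_{0N}(x - ξ_N - η/2) ⋯ R₀₁(x - ξ₁ - η/2)`. -/
def bulkM (x : ℂ) : AuxOp N :=
  ((List.finRange N).reverse.map fun n => RSite P n (x - P.ξ n - P.η / 2)).prod

def sigmaY : Matrix (Fin 2) (Fin 2) ℂ := !![0, -Complex.I; Complex.I, 0]

/-- `M̂(x) = (-1)^N σ₀^y M(-x)^{t₀} σ₀^y`, where `t₀` transposes the auxiliary space only. -/
def bulkMhat (x : ℂ) : AuxOp N :=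
  ((-1 : ℂ) ^ N) • (scalarMat sigmaY * (bulkM P (-x))ᵀ * scalarMat sigmaY)

/-- The scalar solution `K(x; ζ, κ, τ)` of the reflection equation. -/
def Kmat (x : ℂ) : Matrix (Fin 2) (Fin 2) ℂ :=
  !![theta4 P.ζ (2 * P.ω) * theta4 (-x + P.ζ) (2 * P.ω) * theta1 (x + P.ζ) (2 * P.ω) /
        theta1 P.ζ (2 * P.ω),
      P.κ * Complex.exp P.τ * theta1 (2 * x) (2 * P.ω) *
          (theta4 x (2 * P.ω) ^ 2 - Complex.exp (-2 * P.τ) * theta1 x (2 * P.ω) ^ 2) *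
          theta4 P.ζ (2 * P.ω) ^ 3 /
        (theta1 P.ζ (2 * P.ω) * theta4 0 (2 * P.ω) ^ 2 * theta4 (2 * x) (2 * P.ω));
      P.κ * Complex.exp (-P.τ) * theta1 (2 * x) (2 * P.ω) *
          (theta4 x (2 * P.ω) ^ 2 - Complex.exp (2 * P.τ) * theta1 x (2 * P.ω) ^ 2) *
          theta4 P.ζ (2 * P.ω) ^ 3 /
        (theta1 P.ζ (2 * P.ω) * theta4 0 (2 * P.ω) ^ 2 * theta4 (2 * x) (2 * P.ω)),
      theta4 P.ζ (2 * P.ω) * theta1 (-x + P.ζ) (2 * P.ω) * theta4 (x + P.ζ) (2 * P.ω) /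
        theta1 P.ζ (2 * P.ω)]

/-- `K₋(x) = K(x - η/2; ζ₋, κ₋, τ₋)`. -/
def Kminus (x : ℂ) : Matrix (Fin 2) (Fin 2) ℂ := Kmat P (x - P.η / 2)

/-- The boundary monodromy matrix `𝒰₋(x) = M₀(x) K₋(x) M̂₀(x)`, with entries
`𝒜₋, ℬ₋, 𝒞₋, 𝒟₋`. -/
def Uminus (x : ℂ) : AuxOp N := bulkM P x * scalarMat (Kminus P x) * bulkMhat P x

def pfun (x : ℂ) : ℂ :=
  2 * theta4 (2 * x + P.η) (2 * P.ω) * theta1 (2 * x - P.η) (2 * P.ω) / theta2 0 P.ω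

/-- The quantum determinant of `𝒰₋`:
`det_q 𝒰₋(x) = p(x - η/2) (𝒜₋(x + η/2) 𝒜₋(η/2 - x) + ℬ₋(x + η/2) 𝒞₋(η/2 - x))`. -/
def qdetU (x : ℂ) : Op N :=
  pfun P (x - P.η / 2) •
    (Uminus P (x + P.η / 2) 0 0 * Uminus P (P.η / 2 - x) 0 0 +
      Uminus P (x + P.η / 2) 0 1 * Uminus P (P.η / 2 - x) 1 0)

/-- The quantum determinant of `K₋`. -/
def qdetK (x : ℂ) : ℂ :=
  pfun P (x - P.η / 2) *
    (Kminus P (x + P.η / 2) 0 0 * Kminus P (P.η / 2 - x) 0 0 +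
      Kminus P (x + P.η / 2) 0 1 * Kminus P (P.η / 2 - x) 1 0)

/-- `a(x) = ∏ₙ θ(x - ξₙ + η/2)`. -/
def bulkEigA (x : ℂ) : ℂ := ∏ n, th P (x - P.ξ n + P.η / 2)

/-- `d(x) = a(x - η)`. -/
def bulkEigD (x : ℂ) : ℂ := bulkEigA P (x - P.η)

/-- The value `a(x + η/2) d(x - η/2)` of the bulk quantum determinant. -/
def qdetM (x : ℂ) : ℂ := bulkEigA P (x + P.η / 2) * bulkEigD P (x - P.η / 2)

/-- The partial trace over the second factor of `ℂ² ⊗ ℂ²`. -/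
def ptrace2 (A : Matrix (Fin 2 × Fin 2) (Fin 2 × Fin 2) (Op N)) : AuxOp N :=
  Matrix.of fun i k => ∑ j, A (i, j) (k, j)

/-- The algebraic adjoint
`𝒰̃₋(x) = - tr₂ (R₁₂(-η) (𝒰₋)₂(x) R₂₁(2x)) / θ(η)`. -/
def Utilde (x : ℂ) : AuxOp N :=
  (-(1 / th P P.η)) •
    ptrace2 (scalarMat (R8V P (-P.η)) * ((1 : AuxOp N) ⊗ₖ Uminus P x) *
      scalarMat (R8V21 P (2 * x)))

/-! ### Gauge transformations -/

/-- The column vector `X_b(x)`. -/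
def Xvec (b x : ℂ) : Fin 2 → ℂ :=
  ![theta2 (x + (P.α + b) * P.η) (2 * P.ω), theta3 (x + (P.α + b) * P.η) (2 * P.ω)]

/-- The column vector `Y_b(x)`. -/
def Yvec (b x : ℂ) : Fin 2 → ℂ :=
  ![theta2 (x + (P.α - b) * P.η) (2 * P.ω), theta3 (x + (P.α - b) * P.η) (2 * P.ω)]

/-- The row vector `X̃_b(x)`; the factor `θ(x + α η) θ(b η)` common to the normalization of
`X̃_b` and to the denominator of `X̄_b` is cancelled. -/
def Xtil (b x : ℂ) : Fin 2 → ℂ :=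
  (1 / (th P (x + (P.α + 1) * P.η) * th P ((b - 1) * P.η))) •
    ![theta3 (x + (P.α + b) * P.η) (2 * P.ω), -theta2 (x + (P.α + b) * P.η) (2 * P.ω)]

/-- The row vector `Ỹ_b(x)`, with the same cancellation. -/
def Ytil (b x : ℂ) : Fin 2 → ℂ :=
  (1 / (th P (x + (P.α + 1) * P.η) * th P ((1 + b) * P.η))) •
    ![-theta3 (x + (P.α - b) * P.η) (2 * P.ω), theta2 (x + (P.α - b) * P.η) (2 * P.ω)]

/-- `G̃(x|b)`, with columns `X_{b+1}(x)` and `Y_{b-1}(x)`. -/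
def Gtil (x b : ℂ) : Matrix (Fin 2) (Fin 2) ℂ :=
  (Matrix.of ![Xvec P (b + 1) x, Yvec P (b - 1) x])ᵀ

/-- `G̃⁻¹(x|b)`, with rows `Ỹ_{b-1}(x)` and `X̃_{b+1}(x)`. -/
def GtilInv (x b : ℂ) : Matrix (Fin 2) (Fin 2) ℂ :=
  Matrix.of ![Ytil P (b - 1) x, Xtil P (b + 1) x]

/-- The gauged boundary monodromy matrix
`𝖴₋(x|b) = G̃⁻¹(x - η/2|b) 𝒰₋(x) G̃(η/2 - x|b)`. -/
def Ugauge (x b : ℂ) : AuxOp N :=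
  scalarMat (GtilInv P (x - P.η / 2) b) * Uminus P x * scalarMat (Gtil P (P.η / 2 - x) b)

/-- `𝖴̃₋(x|b) = G̃⁻¹(-x - η/2|b) 𝒰̃₋(x) G̃(η/2 + x|b)`. -/
def UgaugeTilde (x b : ℂ) : AuxOp N :=
  scalarMat (GtilInv P (-x - P.η / 2) b) * Utilde P x * scalarMat (Gtil P (P.η / 2 + x) b)

def rfun (x : ℂ) : ℂ :=
  theta4 (2 * x - P.η) (2 * P.ω) * th P (x + (P.α + 1 / 2) * P.η)

/-! The rescaled gauged generators. The entries of `𝖴₋(x|b)` are, up to the rescaling,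
`𝒜₋(x|b+2), ℬ₋(x|b)` in the first row and `𝒞₋(x|b+2), 𝒟₋(x|b)` in the second. -/

def genA (x b : ℂ) : Op N := rfun P x • Ugauge P x (b - 2) 0 0

def genB (x b : ℂ) : Op N := rfun P x • Ugauge P x b 0 1

def genC (x b : ℂ) : Op N := rfun P x • Ugauge P x (b - 2) 1 0

def genD (x b : ℂ) : Op N := rfun P x • Ugauge P x b 1 1

/-- An operator on the chain, extended by the identity on the auxiliary space. -/
def onChain (T : Op N) : AuxOp N := Matrix.diagonal fun _ => T

end EightVertex

end

/-! The theorem rests on two properties of the ungauged matrix `Uminus`, and on coordinates in which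
the gauge transformation is compatible with them.

Inversion. The weights satisfy L(u) σʸ L(u-η)ᵗ = θ(u+η) θ(u-η) σʸ, with t acting on the auxiliary
space only. Hence M and M̂ are inverse to each other up to scalars at matching arguments. Since
K(-x) is the adjugate of K(x), the product 𝒰₋(x+η/2) 𝒰₋(η/2-x) telescopes to a scalar, even in x
(`Uminus_mul_Uminus`). In the gauged product the inner factors G̃(-x|b) G̃⁻¹(-x|b) cancel, so the
same scalar appears; its diagonal entries express the quantum determinant through the gauged
generators.

Parity. Let J be the antisymmetric form and read 𝒰₋(x) J as a vector in the tensor square of the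
auxiliary space. Up to sign it is M₁(x) M₂(-x) applied to the vector of K₋(x). The Yang-Baxter
equation carries R(2x) through M₁(x) M₂(-x), so the relation "R(2x) sends the vector at x to -p(x)
times the flipped vector at -x" passes from K₋ to 𝒰₋ (`parityRelation_Uminus`); the reflection
equation is not needed. As R(-η) has rank one when θ(η) ≠ 0, the same relation gives 𝒰̃₋(x) = p(x)
𝒰₋(-x).

Gauge. Put z = x+η/2 and y = x-η/2. Away from zeros of θⱼ(z|ω), the eigenvalues of R(2x) are θ(2z)
θⱼ(y|ω)/θⱼ(z|ω), j = 1, ..., 4. In the eigenbasis each gauged generator is a multiple of Σⱼ θⱼ(s|ω)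
θⱼ(d|ω) Uⱼ (`gaugeForm`), where only d depends on x. For ℬ₋ and 𝒞₋ one has d = y, and x → -x gives d
= -z: the eigenvalue exchanges θⱼ(z) and θⱼ(y) with a factor common to all j, whence the independent
relations. The generators 𝒜₋ and 𝒟₋ share s and have d = z ∓ (b-1)η; a three-term theta relation,
the same for all four j, mixes them.

All theta identities used descend from one product formula, obtained by splitting a double series
over ℤ² according to parity (`jacobiTheta₂_mul`). -/

noncomputable section

namespace EightVertex

/-! ### Theta functions: product formulas -/

/-- Pairs of integers, split according to the parity of their sum. -/
def intPairParity : (ℤ × ℤ) ⊕ (ℤ × ℤ) ≃ ℤ × ℤ where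
  toFun := Sum.elim (fun p => (p.1 + p.2, p.1 - p.2)) (fun p => (p.1 + p.2 + 1, p.1 - p.2))
  invFun p := if (p.1 + p.2) % 2 = 0 then .inl ((p.1 + p.2) / 2, (p.1 - p.2) / 2)
    else .inr ((p.1 + p.2 - 1) / 2, (p.1 - p.2 - 1) / 2)
  left_inv := by
    rintro (⟨k, l⟩ | ⟨k, l⟩)
    · have h : (k + l + (k - l)) % 2 = 0 := by omega
      simp only [Sum.elim_inl, h, if_true, Sum.inl.injEq, Prod.mk.injEq]
      omega
    · have h : ¬ (k + l + 1 + (k - l)) % 2 = 0 := by omega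
      simp only [Sum.elim_inr, h, if_false, Sum.inr.injEq, Prod.mk.injEq]
      omega
  right_inv := by
    rintro ⟨n, m⟩
    by_cases h : (n + m) % 2 = 0
    · simp only [h, if_true, Sum.elim_inl, Prod.mk.injEq]
      omega
    · simp only [h, if_false, Sum.elim_inr, Prod.mk.injEq]
      omega

/-- Multiply the series and substitute (n, m) = (k+l, k-l) for equal parities, (k+l+1, k-l) for
opposite ones. Then n² + m² is 2(k²+l²), respectively 2(k²+l²) + 2(k+l) + 1, so each half factors
into two series with parameter 2t; the linear terms 2(k+l) become the shifts by t. -/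
lemma jacobiTheta₂_mul (z w : ℂ) {t : ℂ} (ht : 0 < t.im) :
    jacobiTheta₂ z t * jacobiTheta₂ w t =
      jacobiTheta₂ (z + w) (2 * t) * jacobiTheta₂ (z - w) (2 * t) +
      Complex.exp (Real.pi * Complex.I * (t + 2 * z)) *
        (jacobiTheta₂ (z + w + t) (2 * t) * jacobiTheta₂ (z - w + t) (2 * t)) := by
  have ht' : 0 < (2 * t).im := by simpa using ht
  have s (x : ℂ) {τ : ℂ} (h : 0 < τ.im) : Summable fun n => ‖jacobiTheta₂_term n x τ‖ :=
    ((summable_jacobiTheta₂_term_iff x τ).2 h).norm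
  have e₁ (p : ℤ × ℤ) : jacobiTheta₂_term (p.1 + p.2) z t * jacobiTheta₂_term (p.1 - p.2) w t =
      jacobiTheta₂_term p.1 (z + w) (2 * t) * jacobiTheta₂_term p.2 (z - w) (2 * t) := by
    simp only [jacobiTheta₂_term, ← Complex.exp_add]
    congr 1; push_cast; ring
  have e₂ (p : ℤ × ℤ) :
      jacobiTheta₂_term (p.1 + p.2 + 1) z t * jacobiTheta₂_term (p.1 - p.2) w t =
      Complex.exp (Real.pi * Complex.I * (t + 2 * z)) *
        (jacobiTheta₂_term p.1 (z + w + t) (2 * t) *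
          jacobiTheta₂_term p.2 (z - w + t) (2 * t)) := by
    simp only [jacobiTheta₂_term, ← Complex.exp_add]
    congr 1; push_cast; ring
  have s₁ := summable_mul_of_summable_norm (s (z + w) ht') (s (z - w) ht')
  have s₂ := (summable_mul_of_summable_norm (s (z + w + t) ht') (s (z - w + t) ht')).mul_left
    (Complex.exp (Real.pi * Complex.I * (t + 2 * z)))
  unfold jacobiTheta₂
  rw [tsum_mul_tsum_of_summable_norm (s z ht) (s w ht),
    tsum_mul_tsum_of_summable_norm (s (z + w) ht') (s (z - w) ht'),
    tsum_mul_tsum_of_summable_norm (s (z + w + t) ht') (s (z - w + t) ht'),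
    ← intPairParity.tsum_eq, Summable.tsum_sum, ← tsum_mul_left]
  · congr 1
    · exact tsum_congr e₁
    · exact tsum_congr e₂
  · exact s₁.congr fun p => (e₁ p).symm
  · exact s₂.congr fun p => (e₂ p).symm

/-! ### Half-period shifts, parity and differentiability in u. -/

section Shifts

variable (u t : ℂ)

lemma pi_ne : (Real.pi : ℂ) ≠ 0 := Complex.ofReal_ne_zero.2 Real.pi_ne_zero

lemma theta3_add_half_pi : theta3 (u + Real.pi / 2) t = theta4 u t := by
  have := pi_ne
  unfold theta3 theta4; congr 1; field_simp

lemma theta2_add_half_pi : theta2 (u + Real.pi / 2) t = -theta1 u t := by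
  have := pi_ne
  unfold theta2 theta1
  have h : Complex.exp (Real.pi * Complex.I * t / 4 + Complex.I * (u + Real.pi / 2)) =
      Complex.exp (Real.pi * Complex.I * t / 4 + Complex.I * u) * Complex.I := by
    have e : Complex.exp (Real.pi / 2 * Complex.I) = Complex.I := Complex.exp_pi_div_two_mul_I
    rw [show Real.pi * Complex.I * t / 4 + Complex.I * (u + Real.pi / 2) =
      Real.pi * Complex.I * t / 4 + Complex.I * u + Real.pi / 2 * Complex.I by ring,
      Complex.exp_add, e]
  rw [h, show (u + Real.pi / 2) / Real.pi + t / 2 = u / Real.pi + t / 2 + 1 / 2 by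
    field_simp; ring]
  ring

lemma theta3_add_pi : theta3 (u + Real.pi) t = theta3 u t := by
  have := pi_ne
  unfold theta3
  rw [show (u + Real.pi) / Real.pi = u / Real.pi + 1 by field_simp, jacobiTheta₂_add_left]

lemma theta2_add_pi : theta2 (u + Real.pi) t = -theta2 u t := by
  have := pi_ne
  unfold theta2
  have h : Complex.exp (Real.pi * Complex.I * t / 4 + Complex.I * (u + Real.pi)) =
      -Complex.exp (Real.pi * Complex.I * t / 4 + Complex.I * u) := by
    rw [← mul_neg_one, ← Complex.exp_pi_mul_I, ← Complex.exp_add]; congr 1; ring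
  rw [h, show (u + Real.pi) / Real.pi + t / 2 = u / Real.pi + t / 2 + 1 by field_simp; ring,
    jacobiTheta₂_add_left]
  ring

lemma theta4_add_half_pi : theta4 (u + Real.pi / 2) t = theta3 u t := by
  rw [← theta3_add_half_pi, ← theta3_add_pi u t]; congr 1; ring

lemma theta1_add_half_pi : theta1 (u + Real.pi / 2) t = theta2 u t := by
  rw [← neg_neg (theta1 _ _), ← theta2_add_half_pi, neg_eq_iff_eq_neg, ← theta2_add_pi]
  congr 1; ring

lemma theta3_neg : theta3 (-u) t = theta3 u t := by
  unfold theta3; rw [neg_div, jacobiTheta₂_neg_left]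

lemma theta4_neg : theta4 (-u) t = theta4 u t := by
  have h := theta4_add_half_pi (-u - Real.pi / 2) t
  rw [sub_add_cancel] at h
  rw [h, ← theta3_neg, ← theta3_add_half_pi]; congr 1; ring

lemma theta2_neg : theta2 (-u) t = theta2 u t := by
  unfold theta2
  rw [← jacobiTheta₂_neg_left, show -(-u / (Real.pi : ℂ) + t / 2) =
    (u / Real.pi - t / 2) by ring, show u / (Real.pi : ℂ) + t / 2 =
    (u / Real.pi - t / 2) + t by ring, jacobiTheta₂_add_left', ← mul_assoc, ← Complex.exp_add]
  have := pi_ne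
  congr 2; field_simp; ring

lemma theta1_neg : theta1 (-u) t = -theta1 u t := by
  have h := theta1_add_half_pi (-u - Real.pi / 2) t
  rw [sub_add_cancel] at h
  rw [h, ← theta2_neg, ← theta2_add_half_pi]; congr 1; ring

lemma theta1_zero : theta1 0 t = 0 := by
  have h := theta1_neg 0 t
  rw [neg_zero] at h
  exact self_eq_neg.1 h

lemma differentiable_theta3 {t : ℂ} (ht : 0 < t.im) : Differentiable ℂ fun u => theta3 u t := by
  intro u
  exact (differentiableAt_jacobiTheta₂_fst _ ht).comp u (differentiableAt_id.div_const _)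

lemma differentiable_theta2 {t : ℂ} (ht : 0 < t.im) : Differentiable ℂ fun u => theta2 u t := by
  intro u
  have h : DifferentiableAt ℂ (fun u : ℂ => u / Real.pi + t / 2) u := by fun_prop
  refine DifferentiableAt.mul (by fun_prop) ?_
  exact (differentiableAt_jacobiTheta₂_fst _ ht).comp u h

lemma differentiable_theta4 {t : ℂ} (ht : 0 < t.im) : Differentiable ℂ fun u => theta4 u t := by
  simp_rw [← theta3_add_half_pi]
  exact (differentiable_theta3 ht).comp (by fun_prop)

lemma differentiable_theta1 {t : ℂ} (ht : 0 < t.im) : Differentiable ℂ fun u => theta1 u t := by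
  have h : (fun u => theta1 u t) = fun u => -theta2 (u + Real.pi / 2) t := by
    funext u; rw [theta2_add_half_pi, neg_neg]
  rw [h]
  exact ((differentiable_theta2 ht).comp (by fun_prop)).neg

end Shifts

/-! ### Products at t as bilinear forms in theta functions at 2t. -/

section Products

variable (x y : ℂ) {t : ℂ} (ht : 0 < t.im)
include ht

lemma theta3_mul_theta3 : theta3 x t * theta3 y t =
    theta3 (x + y) (2 * t) * theta3 (x - y) (2 * t) +
      theta2 (x + y) (2 * t) * theta2 (x - y) (2 * t) := by
  have := pi_ne
  unfold theta3 theta2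
  rw [jacobiTheta₂_mul _ _ ht, add_div, sub_div]
  have h : Complex.exp (Real.pi * Complex.I * (t + 2 * (x / Real.pi))) =
      Complex.exp (Real.pi * Complex.I * (2 * t) / 4 + Complex.I * (x + y)) *
      Complex.exp (Real.pi * Complex.I * (2 * t) / 4 + Complex.I * (x - y)) := by
    rw [← Complex.exp_add]; congr 1; field_simp; ring
  rw [h, mul_div_cancel_left₀ t two_ne_zero]
  ring

/-- Here the second half of the double series is shifted by a full quasi-period 2t; the
quasi-periodicity factor combines with the prefactors into the one belonging to θ₂(x-y|2t). -/
lemma theta2_mul_theta2 : theta2 x t * theta2 y t =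
    theta2 (x + y) (2 * t) * theta3 (x - y) (2 * t) +
      theta3 (x + y) (2 * t) * theta2 (x - y) (2 * t) := by
  have := pi_ne
  unfold theta3 theta2
  rw [mul_mul_mul_comm, jacobiTheta₂_mul _ _ ht,
    show x / Real.pi + t / 2 + (y / Real.pi + t / 2) + t = (x + y) / Real.pi + 2 * t by ring,
    jacobiTheta₂_add_left',
    show x / Real.pi + t / 2 + (y / Real.pi + t / 2) = (x + y) / Real.pi + 2 * t / 2 by ring,
    show x / Real.pi + t / 2 - (y / Real.pi + t / 2) = (x - y) / Real.pi by ring,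
    mul_div_cancel_left₀ t two_ne_zero, mul_add, ← Complex.exp_add]
  have h₁ : Complex.exp (Real.pi * Complex.I * t / 4 + Complex.I * x +
        (Real.pi * Complex.I * t / 4 + Complex.I * y)) =
      Complex.exp (Real.pi * Complex.I * (2 * t) / 4 + Complex.I * (x + y)) := by
    congr 1; ring
  have h₂ : Complex.exp (Real.pi * Complex.I * (2 * t) / 4 + Complex.I * (x + y)) *
        Complex.exp (Real.pi * Complex.I * (t + 2 * (x / Real.pi + t / 2))) *
        Complex.exp (-Real.pi * Complex.I * (2 * t + 2 * ((x + y) / Real.pi))) =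
      Complex.exp (Real.pi * Complex.I * (2 * t) / 4 + Complex.I * (x - y)) := by
    rw [← Complex.exp_add, ← Complex.exp_add]; congr 1; field_simp; ring
  rw [h₁, ← h₂]
  ring

lemma theta4_mul_theta4 : theta4 x t * theta4 y t =
    theta3 (x + y) (2 * t) * theta3 (x - y) (2 * t) -
      theta2 (x + y) (2 * t) * theta2 (x - y) (2 * t) := by
  rw [← theta3_add_half_pi, ← theta3_add_half_pi, theta3_mul_theta3 _ _ ht,
    show x + Real.pi / 2 + (y + Real.pi / 2) = x + y + (Real.pi : ℂ) by ring,
    add_sub_add_right_eq_sub, theta3_add_pi, theta2_add_pi]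
  ring

lemma theta1_mul_theta1 : theta1 x t * theta1 y t =
    theta3 (x + y) (2 * t) * theta2 (x - y) (2 * t) -
      theta2 (x + y) (2 * t) * theta3 (x - y) (2 * t) := by
  rw [← neg_mul_neg, ← theta2_add_half_pi, ← theta2_add_half_pi, theta2_mul_theta2 _ _ ht,
    show x + Real.pi / 2 + (y + Real.pi / 2) = x + y + (Real.pi : ℂ) by ring,
    add_sub_add_right_eq_sub, theta3_add_pi, theta2_add_pi]
  ring

lemma theta1_mul_theta2 : theta1 x t * theta2 y t =
    theta1 (x + y) (2 * t) * theta4 (x - y) (2 * t) +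
      theta4 (x + y) (2 * t) * theta1 (x - y) (2 * t) := by
  rw [← neg_neg (theta1 x t), ← theta2_add_half_pi, neg_mul, theta2_mul_theta2 _ _ ht,
    show x + Real.pi / 2 + y = x + y + (Real.pi : ℂ) / 2 by ring,
    show x + Real.pi / 2 - y = x - y + (Real.pi : ℂ) / 2 by ring]
  simp only [theta3_add_half_pi, theta2_add_half_pi]
  ring

lemma theta4_mul_theta3 : theta4 x t * theta3 y t =
    theta4 (x + y) (2 * t) * theta4 (x - y) (2 * t) +
      theta1 (x + y) (2 * t) * theta1 (x - y) (2 * t) := by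
  rw [← theta3_add_half_pi, theta3_mul_theta3 _ _ ht,
    show x + Real.pi / 2 + y = x + y + (Real.pi : ℂ) / 2 by ring,
    show x + Real.pi / 2 - y = x - y + (Real.pi : ℂ) / 2 by ring]
  simp only [theta3_add_half_pi, theta2_add_half_pi]
  ring

lemma theta3_mul_theta4 : theta3 x t * theta4 y t =
    theta4 (x + y) (2 * t) * theta4 (x - y) (2 * t) -
      theta1 (x + y) (2 * t) * theta1 (x - y) (2 * t) := by
  rw [mul_comm, theta4_mul_theta3 _ _ ht, add_comm y x, ← neg_sub x y, theta4_neg, theta1_neg]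
  ring

end Products

/-! ### Nonvanishing theta constants. -/

section Nonvanishing

variable {t : ℂ} (ht : 0 < t.im)
include ht

lemma theta4_zero_two_mul : theta4 0 (2 * t) ^ 2 = theta3 0 t * theta4 0 t := by
  rw [theta3_mul_theta4 _ _ ht, add_zero, sub_zero, theta1_zero]; ring

-- As n² and n have the same parity, the sign (-1)ⁿ equals exp(πi n²), which is the effect of t →
-- t+1.
omit ht in
lemma theta4_zero_eq_jacobiTheta (t : ℂ) : theta4 0 t = jacobiTheta (t + 1) := by
  unfold theta4 jacobiTheta₂ jacobiTheta
  refine tsum_congr fun n => ?_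
  simp only [jacobiTheta₂_term]
  rw [show Real.pi * Complex.I * (n : ℂ) ^ 2 * (t + 1) =
    (2 * Real.pi * Complex.I * n * (0 / Real.pi + 1 / 2) + Real.pi * Complex.I * n ^ 2 * t) +
      ((n * (n - 1) / 2 : ℂ)) * (2 * Real.pi * Complex.I) by ring]
  obtain ⟨k, hk⟩ := Int.even_mul_pred_self n
  have : (n * (n - 1) / 2 : ℂ) = (k : ℤ) := by
    rw [← Int.cast_one, ← Int.cast_sub, ← Int.cast_mul, hk]; push_cast; ring
  rw [this, Complex.exp_add _ (((k : ℤ) : ℂ) * _), Complex.exp_int_mul_two_pi_mul_I, mul_one]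

/-- By the doubling relation θ₄(0|2t)² = θ₃(0|t) θ₄(0|t), a zero at t propagates to 2ⁿt for all n.
But θ₄(0|·) tends to 1 as the imaginary part grows. -/
lemma theta4_zero_ne_zero : theta4 0 t ≠ 0 := by
  intro h0
  have h (n : ℕ) : theta4 0 (2 ^ n * t) = 0 := by
    induction n with
    | zero => simpa using h0
    | succ n ih =>
      have hn : 0 < (2 ^ n * t).im := by
        rw [show (2 : ℂ) ^ n = ((2 ^ n : ℝ) : ℂ) by push_cast; rfl, Complex.im_ofReal_mul]
        positivity
      have := theta4_zero_two_mul hn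
      rw [ih, mul_zero] at this
      rw [pow_succ', mul_assoc]
      exact pow_eq_zero_iff two_ne_zero |>.1 this
  have him (n : ℕ) : (2 ^ n * t + 1).im = 2 ^ n * t.im := by
    rw [Complex.add_im, show (2 : ℂ) ^ n = ((2 ^ n : ℝ) : ℂ) by push_cast; rfl,
      Complex.im_ofReal_mul]
    simp
  -- With theta value 0, the norm bounded here is |0 - 1| = 1, while the bound itself tends to 0.
  have h1 (n : ℕ) : (1 : ℝ) ≤ 2 / (1 - Real.exp (-Real.pi * (2 ^ n * t.im))) *
      Real.exp (-Real.pi * (2 ^ n * t.im)) := by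
    have := norm_jacobiTheta_sub_one_le (τ := 2 ^ n * t + 1) (by rw [him]; positivity)
    rw [← theta4_zero_eq_jacobiTheta, h, him] at this
    simpa using this
  have hE : Filter.Tendsto (fun n : ℕ => Real.exp (-Real.pi * (2 ^ n * t.im)))
      Filter.atTop (nhds 0) := by
    refine Real.tendsto_exp_atBot.comp ?_
    refine Filter.Tendsto.const_mul_atTop_of_neg (by simpa using Real.pi_pos) ?_
    exact (tendsto_pow_atTop_atTop_of_one_lt one_lt_two).atTop_mul_const ht
  have hF := ((tendsto_const_nhds (x := (2 : ℝ))).div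
    ((tendsto_const_nhds (x := (1 : ℝ))).sub hE) (by simp)).mul hE
  have := ge_of_tendsto' hF h1
  norm_num at this

lemma theta3_zero_ne_zero : theta3 0 t ≠ 0 := by
  intro h
  have := theta4_zero_two_mul ht
  rw [h, zero_mul] at this
  exact theta4_zero_ne_zero (t := 2 * t) (by simpa using ht) (pow_eq_zero_iff two_ne_zero |>.1 this)

/-- The modular transformation t → -1/t turns θ₂(0|t) into a nonzero multiple of θ₄(0|-1/t). -/
lemma theta2_zero_ne_zero : theta2 0 t ≠ 0 := by
  have h0 : t ≠ 0 := by rintro rfl; simp at ht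
  unfold theta2
  rw [jacobiTheta₂_functional_equation]
  refine mul_ne_zero (Complex.exp_ne_zero _)
    (mul_ne_zero (mul_ne_zero (one_div_ne_zero ?_) (Complex.exp_ne_zero _)) ?_)
  · rw [Complex.cpow_ne_zero_iff]; left
    exact mul_ne_zero (neg_ne_zero.2 Complex.I_ne_zero) h0
  · have := theta4_zero_ne_zero (t := -1 / t) (by
      rw [neg_div, one_div, Complex.neg_im, Complex.inv_im, neg_div, neg_neg]
      exact div_pos ht (Complex.normSq_pos.2 h0))
    unfold theta4 at this
    convert this using 2
    field_simp; ring

end Nonvanishing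

end EightVertex

end

noncomputable section

namespace EightVertex

/-! ### Quartic identities -/

section Quartic

variable {t : ℂ} (ht : 0 < t.im) {x y h xh yh s d : ℂ}
include ht

/-- Pairing x with y and x+h with y+h gives products at 2t with the same difference x-y. The quartic
form then factors into a part in x-y and a part in the two sums, each again a product at t. -/
lemma theta4_quartic (hx : xh = x + h) (hy : yh = y + h) (hs : s = x + y + h) (hd : d = y - x) :
    theta4 x t * theta4 xh t * theta4 y t * theta4 yh t -
        theta1 x t * theta1 xh t * theta1 y t * theta1 yh t =
      theta4 0 t * theta4 h t * theta4 s t * theta4 d t := by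
  subst hx hy hs hd
  have e₁ := theta4_mul_theta4 x y ht
  have e₂ := theta4_mul_theta4 (x + h) (y + h) ht
  have e₃ := theta1_mul_theta1 x y ht
  have e₄ := theta1_mul_theta1 (x + h) (y + h) ht
  have e₅ := theta4_mul_theta4 (x - y) 0 ht
  have e₆ := theta4_mul_theta4 h (x + y + h) ht
  rw [add_zero, sub_zero] at e₅
  rw [show x + h + (y + h) = x + y + 2 * h by ring, add_sub_add_right_eq_sub] at e₂ e₄
  rw [show h + (x + y + h) = x + y + 2 * h by ring, show h - (x + y + h) = -(x + y) by ring,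
    theta3_neg, theta2_neg] at e₆
  rw [← neg_sub x y, theta4_neg]
  calc _ = (theta4 x t * theta4 y t) * (theta4 (x + h) t * theta4 (y + h) t) -
        (theta1 x t * theta1 y t) * (theta1 (x + h) t * theta1 (y + h) t) := by ring
    _ = (theta4 (x - y) t * theta4 0 t) * (theta4 h t * theta4 (x + y + h) t) := by
      rw [e₁, e₂, e₃, e₄, e₅, e₆]; ring
    _ = _ := by ring

lemma theta1_quartic (hx : xh = x + h) (hy : yh = y + h) (hs : s = x + y + h) (hd : d = y - x) :
    theta4 x t * theta1 xh t * theta4 y t * theta1 yh t -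
        theta1 x t * theta4 xh t * theta1 y t * theta4 yh t =
      theta4 0 t * theta1 h t * theta1 s t * theta4 d t := by
  subst hx hy hs hd
  have e₁ := theta4_mul_theta4 x y ht
  have e₂ := theta4_mul_theta4 (x + h) (y + h) ht
  have e₃ := theta1_mul_theta1 x y ht
  have e₄ := theta1_mul_theta1 (x + h) (y + h) ht
  have e₅ := theta4_mul_theta4 (x - y) 0 ht
  have e₆ := theta1_mul_theta1 h (x + y + h) ht
  rw [add_zero, sub_zero] at e₅
  rw [show x + h + (y + h) = x + y + 2 * h by ring, add_sub_add_right_eq_sub] at e₂ e₄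
  rw [show h + (x + y + h) = x + y + 2 * h by ring, show h - (x + y + h) = -(x + y) by ring,
    theta3_neg, theta2_neg] at e₆
  rw [← neg_sub x y, theta4_neg]
  calc _ = (theta4 x t * theta4 y t) * (theta1 (x + h) t * theta1 (y + h) t) -
        (theta1 x t * theta1 y t) * (theta4 (x + h) t * theta4 (y + h) t) := by ring
    _ = (theta4 (x - y) t * theta4 0 t) * (theta1 h t * theta1 (x + y + h) t) := by
      rw [e₁, e₂, e₃, e₄, e₅, e₆]; ring
    _ = _ := by ring

/-- This is `theta1_quartic` under y → -(y+h), which exchanges s and d up to sign. -/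
lemma theta1_quartic_cross (hx : xh = x + h) (hy : yh = y + h) (hs : s = x + y + h)
    (hd : d = y - x) :
    theta4 x t * theta1 xh t * theta1 y t * theta4 yh t -
        theta1 x t * theta4 xh t * theta4 y t * theta1 yh t =
      theta4 0 t * theta1 h t * theta4 s t * theta1 d t := by
  have := theta1_quartic ht (x := x) (y := -yh) (h := h) (xh := xh) (yh := -y) (s := -d)
    (d := -s) hx (by rw [hy]; ring) (by rw [hd, hy]; ring) (by rw [hs, hy]; ring)
  simp only [theta1_neg, theta4_neg] at this
  linear_combination -this

/-- This is `theta1_quartic` with the roles of h and d exchanged: the four points also form the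
pairs (x, y) and (x+h, y+h) with step d. -/
lemma theta1_quartic_pair (hx : xh = x + h) (hy : yh = y + h) (hs : s = x + y + h)
    (hd : d = y - x) :
    theta4 x t * theta4 xh t * theta1 y t * theta1 yh t -
        theta1 x t * theta1 xh t * theta4 y t * theta4 yh t =
      theta4 0 t * theta4 h t * theta1 s t * theta1 d t := by
  have := theta1_quartic ht (x := x) (y := xh) (h := d) (xh := y) (yh := yh) (s := s) (d := h)
    (by rw [hd]; ring) (by rw [hd, hy, hx]; ring) (by rw [hs, hd, hx]; ring) (by rw [hx]; ring)
  linear_combination this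

end Quartic

/-! ### Weights of the eight-vertex model -/

section Weights

variable {N : ℕ} (P : Params N)

/-! ### The six scalar Yang-Baxter relations. -/

section YangBaxter

variable (hω : 0 < P.ω.im) {u v w : ℂ} (hu : u = w + v)
include hω hu

/-- After common factors are removed, the four terms are left sides of two quartic identities, with
coefficients for which the two right sides cancel. The other five relations follow in the same way;
they differ in which two of w, u, v enter the quartic identities. -/
lemma yangBaxter_aad : coefA P w * coefA P u * coefD P v + coefD P w * coefC P u * coefA P v =
    coefB P w * coefB P u * coefD P v + coefC P w * coefD P u * coefA P v := by
  have ht : 0 < (2 * P.ω).im := by simpa using hω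
  have e₁ := theta1_quartic ht (x := w) (y := u) (h := P.η) (d := v) rfl rfl rfl (by rw [hu]; ring)
  have e₂ := theta1_quartic_pair ht (x := w) (y := u) (h := P.η) (d := v) rfl rfl rfl
    (by rw [hu]; ring)
  unfold coefA coefB coefC coefD
  linear_combination (2 / (theta2 0 P.ω * theta4 0 (2 * P.ω))) ^ 3 * theta1 P.η (2 * P.ω) *
    theta4 P.η (2 * P.ω) * theta1 (v + P.η) (2 * P.ω) *
    (theta4 P.η (2 * P.ω) * theta1 v (2 * P.ω) * e₁ -
      theta1 P.η (2 * P.ω) * theta4 v (2 * P.ω) * e₂)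

lemma yangBaxter_abc : coefA P w * coefB P u * coefC P v + coefD P w * coefD P u * coefB P v =
    coefB P w * coefA P u * coefC P v + coefC P w * coefC P u * coefB P v := by
  have ht : 0 < (2 * P.ω).im := by simpa using hω
  have e₁ := theta1_quartic_cross ht (x := w) (y := u) (h := P.η) (d := v) rfl rfl rfl
    (by rw [hu]; ring)
  have e₂ := theta4_quartic ht (x := w) (y := u) (h := P.η) (d := v) rfl rfl rfl
    (by rw [hu]; ring)
  unfold coefA coefB coefC coefD
  linear_combination (2 / (theta2 0 P.ω * theta4 0 (2 * P.ω))) ^ 3 * theta1 P.η (2 * P.ω) *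
    theta4 P.η (2 * P.ω) * theta4 (v + P.η) (2 * P.ω) *
    (theta4 P.η (2 * P.ω) * theta4 v (2 * P.ω) * e₁ -
      theta1 P.η (2 * P.ω) * theta1 v (2 * P.ω) * e₂)

lemma yangBaxter_aca : coefA P w * coefC P u * coefA P v + coefD P w * coefA P u * coefD P v =
    coefB P w * coefC P u * coefB P v + coefC P w * coefA P u * coefC P v := by
  have ht : 0 < (2 * P.ω).im := by simpa using hω
  have e₁ := theta1_quartic ht (x := w) (y := v) (h := P.η) (s := u + P.η) rfl rfl
    (by rw [hu]) rfl
  have e₂ := theta4_quartic ht (x := w) (y := v) (h := P.η) (s := u + P.η) rfl rfl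
    (by rw [hu]) rfl
  unfold coefA coefB coefC coefD
  linear_combination (2 / (theta2 0 P.ω * theta4 0 (2 * P.ω))) ^ 3 * theta1 P.η (2 * P.ω) *
    theta4 P.η (2 * P.ω) * theta4 u (2 * P.ω) *
    (theta4 P.η (2 * P.ω) * theta4 (u + P.η) (2 * P.ω) * e₁ -
      theta1 P.η (2 * P.ω) * theta1 (u + P.η) (2 * P.ω) * e₂)

lemma yangBaxter_acd : coefA P w * coefC P u * coefD P v + coefD P w * coefA P u * coefA P v =
    coefD P w * coefB P u * coefB P v + coefA P w * coefD P u * coefC P v := by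
  have ht : 0 < (2 * P.ω).im := by simpa using hω
  have e₁ := theta1_quartic ht (x := v) (y := u) (h := P.η) (d := w) rfl rfl rfl (by rw [hu]; ring)
  have e₂ := theta1_quartic_pair ht (x := v) (y := u) (h := P.η) (d := w) rfl rfl rfl
    (by rw [hu]; ring)
  unfold coefA coefB coefC coefD
  linear_combination (2 / (theta2 0 P.ω * theta4 0 (2 * P.ω))) ^ 3 * theta1 P.η (2 * P.ω) *
    theta4 P.η (2 * P.ω) * theta1 (w + P.η) (2 * P.ω) *
    (theta4 P.η (2 * P.ω) * theta1 w (2 * P.ω) * e₁ -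
      theta1 P.η (2 * P.ω) * theta4 w (2 * P.ω) * e₂)

lemma yangBaxter_adb : coefA P w * coefD P u * coefB P v + coefD P w * coefB P u * coefC P v =
    coefC P w * coefB P u * coefD P v + coefB P w * coefD P u * coefA P v := by
  have ht : 0 < (2 * P.ω).im := by simpa using hω
  have e₁ := theta1_quartic_cross ht (x := w) (y := v) (h := P.η) (s := u + P.η) rfl rfl
    (by rw [hu]) rfl
  have e₂ := theta1_quartic_pair ht (x := w) (y := v) (h := P.η) (s := u + P.η) rfl rfl
    (by rw [hu]) rfl
  unfold coefA coefB coefC coefD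
  linear_combination (2 / (theta2 0 P.ω * theta4 0 (2 * P.ω))) ^ 3 * theta1 P.η (2 * P.ω) *
    theta4 P.η (2 * P.ω) * theta1 u (2 * P.ω) *
    (theta4 P.η (2 * P.ω) * theta1 (u + P.η) (2 * P.ω) * e₁ -
      theta1 P.η (2 * P.ω) * theta4 (u + P.η) (2 * P.ω) * e₂)

lemma yangBaxter_bdd : coefB P w * coefD P u * coefD P v + coefC P w * coefB P u * coefA P v =
    coefC P w * coefA P u * coefB P v + coefB P w * coefC P u * coefC P v := by
  have ht : 0 < (2 * P.ω).im := by simpa using hω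
  have e₁ := theta1_quartic_cross ht (x := v) (y := u) (h := P.η) (d := w) rfl rfl rfl
    (by rw [hu]; ring)
  have e₂ := theta4_quartic ht (x := v) (y := u) (h := P.η) (d := w) rfl rfl rfl
    (by rw [hu]; ring)
  unfold coefA coefB coefC coefD
  linear_combination (2 / (theta2 0 P.ω * theta4 0 (2 * P.ω))) ^ 3 * theta1 P.η (2 * P.ω) *
    theta4 P.η (2 * P.ω) * theta4 (w + P.η) (2 * P.ω) *
    (theta4 P.η (2 * P.ω) * theta4 w (2 * P.ω) * e₁ -
      theta1 P.η (2 * P.ω) * theta1 w (2 * P.ω) * e₂)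

end YangBaxter

/-- The normalization `2 / (θ₂(0|ω) θ₄(0|2ω)²)`. -/
def weightConst : ℂ := 2 / (theta2 0 P.ω * theta4 0 (2 * P.ω) ^ 2)

/-! ### Eigenvalues of the R-matrix in theta functions of period parameter ω. -/

section Spectral

variable (hω : 0 < P.ω.im)
include hω

lemma theta1_two_mul_double (z : ℂ) : theta1 (2 * z) (2 * P.ω) * theta4 0 (2 * P.ω) =
    theta1 z P.ω * theta2 z P.ω := by
  rw [theta1_mul_theta2 _ _ hω, sub_self, theta1_zero, two_mul z]; ring

lemma theta4_two_mul_double (z : ℂ) : theta4 (2 * z) (2 * P.ω) * theta4 0 (2 * P.ω) =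
    theta3 z P.ω * theta4 z P.ω := by
  rw [theta3_mul_theta4 _ _ hω, sub_self, theta1_zero, two_mul z]; ring

lemma theta1_mul_theta4_double (z : ℂ) :
    2 * theta1 z (2 * P.ω) * theta4 z (2 * P.ω) = th P z * theta2 0 P.ω := by
  rw [th, theta1_mul_theta2 _ _ hω, add_zero, sub_zero]; ring

/-- The duplication formula. It identifies the product of the factor at z in each eigenvalue below
with the missing θⱼ(z) as θ(2z). -/
lemma th_two_mul (z : ℂ) : weightConst P * (theta1 z P.ω * theta2 z P.ω * theta3 z P.ω *
    theta4 z P.ω) = th P (2 * z) := by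
  have h₂ := theta2_zero_ne_zero hω
  have h₄ := theta4_zero_ne_zero (t := 2 * P.ω) (by simpa using hω)
  have e₁ := theta1_two_mul_double P hω z
  have e₂ := theta4_two_mul_double P hω z
  have e₃ := theta1_mul_theta4_double P hω (2 * z)
  rw [mul_assoc (_ * _), ← e₂, ← e₁, weightConst]
  field_simp
  linear_combination e₃

variable {u z y : ℂ} (hz : u + P.η = 2 * z) (hy : u = z + y)
include hz hy

/-- Since u = z+y and η = z-y, the combination of products at 2ω is a single product at ω. Each of
the four eigenvalues a ∓ d, b ± c carries three of the θⱼ at z and the remaining one at y. -/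
lemma coefA_sub_coefD : coefA P u - coefD P u =
    weightConst P * (theta1 z P.ω * theta2 z P.ω * theta3 z P.ω) * theta4 y P.ω := by
  have h₂ := theta2_zero_ne_zero hω
  have h₄ := theta4_zero_ne_zero (t := 2 * P.ω) (by simpa using hω)
  have e₂ := theta3_mul_theta4 z y hω
  rw [← hy, show z - y = P.η by linear_combination hy - hz] at e₂
  rw [coefA, coefD, weightConst, hz, ← theta1_two_mul_double P hω]
  field_simp
  linear_combination -theta1 (2 * z) (2 * P.ω) * e₂

lemma coefA_add_coefD : coefA P u + coefD P u =
    weightConst P * (theta1 z P.ω * theta2 z P.ω * theta4 z P.ω) * theta3 y P.ω := by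
  have h₂ := theta2_zero_ne_zero hω
  have h₄ := theta4_zero_ne_zero (t := 2 * P.ω) (by simpa using hω)
  have e₂ := theta4_mul_theta3 z y hω
  rw [← hy, show z - y = P.η by linear_combination hy - hz] at e₂
  rw [coefA, coefD, weightConst, hz, ← theta1_two_mul_double P hω]
  field_simp
  linear_combination -theta1 (2 * z) (2 * P.ω) * e₂

lemma coefB_add_coefC : coefB P u + coefC P u =
    weightConst P * (theta1 z P.ω * theta3 z P.ω * theta4 z P.ω) * theta2 y P.ω := by
  have h₂ := theta2_zero_ne_zero hω
  have h₄ := theta4_zero_ne_zero (t := 2 * P.ω) (by simpa using hω)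
  have e₂ := theta1_mul_theta2 z y hω
  rw [← hy, show z - y = P.η by linear_combination hy - hz] at e₂
  rw [mul_assoc (theta1 z P.ω), coefB, coefC, weightConst, hz, ← theta4_two_mul_double P hω]
  field_simp
  linear_combination -theta4 (2 * z) (2 * P.ω) * e₂

lemma coefB_sub_coefC : coefB P u - coefC P u =
    weightConst P * (theta2 z P.ω * theta3 z P.ω * theta4 z P.ω) * theta1 y P.ω := by
  have h₂ := theta2_zero_ne_zero hω
  have h₄ := theta4_zero_ne_zero (t := 2 * P.ω) (by simpa using hω)
  have e₂ := theta1_mul_theta2 y z hω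
  rw [add_comm y z, ← hy, show y - z = -P.η by linear_combination hz - hy,
    theta1_neg, theta4_neg] at e₂
  rw [mul_assoc (theta2 z P.ω), coefB, coefC, weightConst, hz, ← theta4_two_mul_double P hω]
  field_simp
  linear_combination -theta4 (2 * z) (2 * P.ω) * e₂

omit hz hy in
lemma pfun_eq (x : ℂ) : pfun P x = weightConst P * (theta3 (x + P.η / 2) P.ω *
    theta4 (x + P.η / 2) P.ω) * (theta1 (x - P.η / 2) P.ω * theta2 (x - P.η / 2) P.ω) := by
  have h₂ := theta2_zero_ne_zero hω
  have h₄ := theta4_zero_ne_zero (t := 2 * P.ω) (by simpa using hω)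
  rw [pfun, weightConst, ← theta4_two_mul_double P hω, ← theta1_two_mul_double P hω,
    show 2 * (x + P.η / 2) = 2 * x + P.η by ring, show 2 * (x - P.η / 2) = 2 * x - P.η by ring]
  field_simp

end Spectral

/-! ### Three-term relations -/

section ThreeTerm

variable {t : ℂ} (ht : 0 < t.im) (y z g : ℂ)
include ht

/-- Both sides become polynomials in θ₂, θ₃ with parameter 2t at 2z+g, 2z-g, 2y-g and g, where the
identity is algebraic. The coefficients are the same for all four theta functions, which is what
later lets the four eigencomponents be treated together. -/
lemma theta1_three_term : theta1 g t * theta1 (2 * z) t * (theta1 y t * theta1 (y - g) t) =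
    theta1 (y + z) t * theta1 (g + z - y) t * (theta1 z t * theta1 (z - g) t) -
    theta1 (z - y) t * theta1 (y + z - g) t * (theta1 z t * theta1 (z + g) t) := by
  simp only [theta1_mul_theta1 _ _ ht]
  rw [show g + 2 * z = 2 * z + g by ring, show g - 2 * z = -(2 * z - g) by ring,
    show y + (y - g) = 2 * y - g by ring, show y - (y - g) = g by ring,
    show y + z + (g + z - y) = 2 * z + g by ring, show y + z - (g + z - y) = 2 * y - g by ring,
    show z + (z - g) = 2 * z - g by ring, show z - (z - g) = g by ring,
    show z - y + (y + z - g) = 2 * z - g by ring, show z - y - (y + z - g) = -(2 * y - g) by ring,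
    show z + (z + g) = 2 * z + g by ring, show z - (z + g) = -g by ring]
  simp only [theta2_neg, theta3_neg]
  ring

lemma theta2_three_term : theta1 g t * theta1 (2 * z) t * (theta2 y t * theta2 (y - g) t) =
    theta1 (y + z) t * theta1 (g + z - y) t * (theta2 z t * theta2 (z - g) t) -
    theta1 (z - y) t * theta1 (y + z - g) t * (theta2 z t * theta2 (z + g) t) := by
  simp only [theta1_mul_theta1 _ _ ht, theta2_mul_theta2 _ _ ht]
  rw [show g + 2 * z = 2 * z + g by ring, show g - 2 * z = -(2 * z - g) by ring,
    show y + (y - g) = 2 * y - g by ring, show y - (y - g) = g by ring,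
    show y + z + (g + z - y) = 2 * z + g by ring, show y + z - (g + z - y) = 2 * y - g by ring,
    show z + (z - g) = 2 * z - g by ring, show z - (z - g) = g by ring,
    show z - y + (y + z - g) = 2 * z - g by ring, show z - y - (y + z - g) = -(2 * y - g) by ring,
    show z + (z + g) = 2 * z + g by ring, show z - (z + g) = -g by ring]
  simp only [theta2_neg, theta3_neg]
  ring

lemma theta3_three_term : theta1 g t * theta1 (2 * z) t * (theta3 y t * theta3 (y - g) t) =
    theta1 (y + z) t * theta1 (g + z - y) t * (theta3 z t * theta3 (z - g) t) -
    theta1 (z - y) t * theta1 (y + z - g) t * (theta3 z t * theta3 (z + g) t) := by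
  simp only [theta1_mul_theta1 _ _ ht, theta3_mul_theta3 _ _ ht]
  rw [show g + 2 * z = 2 * z + g by ring, show g - 2 * z = -(2 * z - g) by ring,
    show y + (y - g) = 2 * y - g by ring, show y - (y - g) = g by ring,
    show y + z + (g + z - y) = 2 * z + g by ring, show y + z - (g + z - y) = 2 * y - g by ring,
    show z + (z - g) = 2 * z - g by ring, show z - (z - g) = g by ring,
    show z - y + (y + z - g) = 2 * z - g by ring, show z - y - (y + z - g) = -(2 * y - g) by ring,
    show z + (z + g) = 2 * z + g by ring, show z - (z + g) = -g by ring]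
  simp only [theta2_neg, theta3_neg]
  ring

lemma theta4_three_term : theta1 g t * theta1 (2 * z) t * (theta4 y t * theta4 (y - g) t) =
    theta1 (y + z) t * theta1 (g + z - y) t * (theta4 z t * theta4 (z - g) t) -
    theta1 (z - y) t * theta1 (y + z - g) t * (theta4 z t * theta4 (z + g) t) := by
  simp only [theta1_mul_theta1 _ _ ht, theta4_mul_theta4 _ _ ht]
  rw [show g + 2 * z = 2 * z + g by ring, show g - 2 * z = -(2 * z - g) by ring,
    show y + (y - g) = 2 * y - g by ring, show y - (y - g) = g by ring,
    show y + z + (g + z - y) = 2 * z + g by ring, show y + z - (g + z - y) = 2 * y - g by ring,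
    show z + (z - g) = 2 * z - g by ring, show z - (z - g) = g by ring,
    show z - y + (y + z - g) = 2 * z - g by ring, show z - y - (y + z - g) = -(2 * y - g) by ring,
    show z + (z + g) = 2 * z + g by ring, show z - (z + g) = -g by ring]
  simp only [theta2_neg, theta3_neg]
  ring

end ThreeTerm

/-- The ring of entire functions has no zero divisors, so a common factor may be cancelled even at
its zeros. -/
lemma eq_of_mul_left_eq_of_differentiable {f g h : ℂ → ℂ} (hf : Differentiable ℂ f)
    (hg : Differentiable ℂ g) (hh : Differentiable ℂ h) {x₀ : ℂ} (h₀ : h x₀ ≠ 0)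
    (H : ∀ x, h x * f x = h x * g x) (x : ℂ) : f x = g x := by
  rcases AnalyticOnNhd.eq_zero_or_eq_zero_of_mul_eq_zero (U := Set.univ) (f := h)
    (g := fun x => f x - g x) (fun x _ => hh.analyticAt x) (fun x _ => (hf.sub hg).analyticAt x)
    (fun x _ => by rw [mul_sub, H, sub_self]) isPreconnected_univ with h | h
  · exact absurd (h x₀ trivial) h₀
  · exact sub_eq_zero.1 (h x trivial)

/-! ### Three-term relations with the factor θⱼ(z) cancelled. -/

section Intertwining

variable (hω : 0 < P.ω.im) (y z g : ℂ)
include hω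

/-- By duplication, θ(2z) in the three-term relation contains θ₁(z), as does every other term. It
may vanish at the given z, so it is cancelled among entire functions of z. The other three cases are
alike. -/
lemma theta1_intertwining : th P g * (weightConst P *
      (theta2 z P.ω * theta3 z P.ω * theta4 z P.ω) * theta1 y P.ω) * theta1 (y - g) P.ω =
    th P (y + z) * th P (g + z - y) * theta1 (z - g) P.ω -
    th P (z - y) * th P (y + z - g) * theta1 (z + g) P.ω := by
  have d₁ := differentiable_theta1 hω
  have d₂ := differentiable_theta2 hω
  have d₃ := differentiable_theta3 hω
  have d₄ := differentiable_theta4 hω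
  -- θ₁ vanishes at 0, so the point where the factor is nonzero is taken at π/2.
  have h₀ : theta1 (0 + Real.pi / 2) P.ω ≠ 0 := by
    rw [theta1_add_half_pi]; exact theta2_zero_ne_zero hω
  unfold th
  refine eq_of_mul_left_eq_of_differentiable (h := fun z => theta1 z P.ω)
    (f := fun z => theta1 g P.ω * (weightConst P *
      (theta2 z P.ω * theta3 z P.ω * theta4 z P.ω) * theta1 y P.ω) * theta1 (y - g) P.ω)
    (g := fun z => theta1 (y + z) P.ω * theta1 (g + z - y) P.ω * theta1 (z - g) P.ω -
      theta1 (z - y) P.ω * theta1 (y + z - g) P.ω * theta1 (z + g) P.ω) ?_ ?_ d₁ h₀ ?_ z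
  · fun_prop
  · exact (((d₁.comp (by fun_prop)).mul (d₁.comp (by fun_prop))).mul (d₁.comp (by fun_prop))).sub
      (((d₁.comp (by fun_prop)).mul (d₁.comp (by fun_prop))).mul (d₁.comp (by fun_prop)))
  · intro z
    have e := theta1_three_term hω y z g
    have e' := th_two_mul P hω z
    rw [th] at e'
    rw [← e'] at e
    linear_combination e

lemma theta2_intertwining : th P g * (weightConst P *
      (theta1 z P.ω * theta3 z P.ω * theta4 z P.ω) * theta2 y P.ω) * theta2 (y - g) P.ω =
    th P (y + z) * th P (g + z - y) * theta2 (z - g) P.ω -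
    th P (z - y) * th P (y + z - g) * theta2 (z + g) P.ω := by
  have d₁ := differentiable_theta1 hω
  have d₂ := differentiable_theta2 hω
  have d₃ := differentiable_theta3 hω
  have d₄ := differentiable_theta4 hω
  unfold th
  refine eq_of_mul_left_eq_of_differentiable (h := fun z => theta2 z P.ω)
    (f := fun z => theta1 g P.ω * (weightConst P *
      (theta1 z P.ω * theta3 z P.ω * theta4 z P.ω) * theta2 y P.ω) * theta2 (y - g) P.ω)
    (g := fun z => theta1 (y + z) P.ω * theta1 (g + z - y) P.ω * theta2 (z - g) P.ω -
      theta1 (z - y) P.ω * theta1 (y + z - g) P.ω * theta2 (z + g) P.ω) ?_ ?_ d₂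
    (theta2_zero_ne_zero hω) ?_ z
  · fun_prop
  · exact (((d₁.comp (by fun_prop)).mul (d₁.comp (by fun_prop))).mul (d₂.comp (by fun_prop))).sub
      (((d₁.comp (by fun_prop)).mul (d₁.comp (by fun_prop))).mul (d₂.comp (by fun_prop)))
  · intro z
    have e := theta2_three_term hω y z g
    have e' := th_two_mul P hω z
    rw [th] at e'
    rw [← e'] at e
    linear_combination e

lemma theta3_intertwining : th P g * (weightConst P *
      (theta1 z P.ω * theta2 z P.ω * theta4 z P.ω) * theta3 y P.ω) * theta3 (y - g) P.ω =
    th P (y + z) * th P (g + z - y) * theta3 (z - g) P.ω -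
    th P (z - y) * th P (y + z - g) * theta3 (z + g) P.ω := by
  have d₁ := differentiable_theta1 hω
  have d₂ := differentiable_theta2 hω
  have d₃ := differentiable_theta3 hω
  have d₄ := differentiable_theta4 hω
  unfold th
  refine eq_of_mul_left_eq_of_differentiable (h := fun z => theta3 z P.ω)
    (f := fun z => theta1 g P.ω * (weightConst P *
      (theta1 z P.ω * theta2 z P.ω * theta4 z P.ω) * theta3 y P.ω) * theta3 (y - g) P.ω)
    (g := fun z => theta1 (y + z) P.ω * theta1 (g + z - y) P.ω * theta3 (z - g) P.ω -
      theta1 (z - y) P.ω * theta1 (y + z - g) P.ω * theta3 (z + g) P.ω) ?_ ?_ d₃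
    (theta3_zero_ne_zero hω) ?_ z
  · fun_prop
  · exact (((d₁.comp (by fun_prop)).mul (d₁.comp (by fun_prop))).mul (d₃.comp (by fun_prop))).sub
      (((d₁.comp (by fun_prop)).mul (d₁.comp (by fun_prop))).mul (d₃.comp (by fun_prop)))
  · intro z
    have e := theta3_three_term hω y z g
    have e' := th_two_mul P hω z
    rw [th] at e'
    rw [← e'] at e
    linear_combination e

lemma theta4_intertwining : th P g * (weightConst P *
      (theta1 z P.ω * theta2 z P.ω * theta3 z P.ω) * theta4 y P.ω) * theta4 (y - g) P.ω =
    th P (y + z) * th P (g + z - y) * theta4 (z - g) P.ω -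
    th P (z - y) * th P (y + z - g) * theta4 (z + g) P.ω := by
  have d₁ := differentiable_theta1 hω
  have d₂ := differentiable_theta2 hω
  have d₃ := differentiable_theta3 hω
  have d₄ := differentiable_theta4 hω
  unfold th
  refine eq_of_mul_left_eq_of_differentiable (h := fun z => theta4 z P.ω)
    (f := fun z => theta1 g P.ω * (weightConst P *
      (theta1 z P.ω * theta2 z P.ω * theta3 z P.ω) * theta4 y P.ω) * theta4 (y - g) P.ω)
    (g := fun z => theta1 (y + z) P.ω * theta1 (g + z - y) P.ω * theta4 (z - g) P.ω -
      theta1 (z - y) P.ω * theta1 (y + z - g) P.ω * theta4 (z + g) P.ω) ?_ ?_ d₄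
    (theta4_zero_ne_zero hω) ?_ z
  · fun_prop
  · exact (((d₁.comp (by fun_prop)).mul (d₁.comp (by fun_prop))).mul (d₄.comp (by fun_prop))).sub
      (((d₁.comp (by fun_prop)).mul (d₁.comp (by fun_prop))).mul (d₄.comp (by fun_prop)))
  · intro z
    have e := theta4_three_term hω y z g
    have e' := th_two_mul P hω z
    rw [th] at e'
    rw [← e'] at e
    linear_combination e

end Intertwining

end Weights

end EightVertex

end

noncomputable section

namespace EightVertex

/-! ### Site operators -/

section SiteOperators

variable {N : ℕ}

lemma update_apply_eq_of_agree {n : Fin N} {s r : Fin N → Fin 2} (h : ∀ m, m ≠ n → s m = r m) :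
    Function.update s n (r n) = r := by
  funext m
  by_cases hm : m = n
  · subst hm; simp
  · rw [Function.update_of_ne hm, h m hm]

lemma siteOp_mul (n : Fin N) (X Y : Matrix (Fin 2) (Fin 2) ℂ) :
    siteOp n (X * Y) = siteOp n X * siteOp n Y := by
  ext s t
  rw [Matrix.mul_apply]
  simp only [siteOp, Matrix.of_apply]
  -- Only intermediate states that agree with s away from n contribute, and these are parametrised
  -- by their value at n.
  rw [← Finset.sum_of_injOn (s := Finset.univ) (t := Finset.univ)
    (f := fun c : Fin 2 => if ∀ m, m ≠ n → s m = t m then X (s n) c * Y c (t n) else 0)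
    (Function.update s n)]
  · split_ifs
    · rw [Matrix.mul_apply]
    · simp
  · intro c _ c' _ h
    simpa using congrFun h n
  · intro c _; simp
  · intro r _ hr
    have : ¬ ∀ m, m ≠ n → s m = r m := fun h =>
      hr ⟨r n, by simp, update_apply_eq_of_agree h⟩
    rw [if_neg this, zero_mul]
  · intro c _
    have h₁ : ∀ m, m ≠ n → s m = Function.update s n c m := fun m hm => by
      rw [Function.update_of_ne hm]
    have h₂ : (∀ m, m ≠ n → Function.update s n c m = t m) ↔ ∀ m, m ≠ n → s m = t m :=
      forall₂_congr fun m hm => by rw [Function.update_of_ne hm]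
    rw [if_pos h₁, if_congr h₂ rfl rfl, Function.update_self]
    split_ifs <;> simp

/-- The embedding of the operators on `ℂ²` at the site `n`. -/
def siteHom (n : Fin N) : Matrix (Fin 2) (Fin 2) ℂ →ₐ[ℂ] Op N :=
  AlgHom.ofLinearMap
    { toFun := siteOp n
      map_add' := fun X Y => by
        ext s t; simp only [siteOp, Matrix.of_apply, Matrix.add_apply]; split_ifs <;> simp
      map_smul' := fun c X => by
        ext s t; simp only [siteOp, Matrix.of_apply, Matrix.smul_apply]; split_ifs <;> simp }
    (by
      ext s t
      simp only [siteOp, LinearMap.coe_mk, AddHom.coe_mk, Matrix.of_apply, Matrix.one_apply]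
      by_cases h : s = t
      · subst h; simp
      · rw [if_neg h]
        split_ifs with h₁ h₂
        · refine absurd (funext fun m => ?_) h
          by_cases hm : m = n
          · rw [hm, h₂]
          · exact h₁ m hm
        · rfl
        · rfl)
    (siteOp_mul n)

lemma siteHom_apply (n : Fin N) (X : Matrix (Fin 2) (Fin 2) ℂ) : siteHom n X = siteOp n X := rfl

lemma siteOp_mul_siteOp_apply {n m : Fin N} (hnm : n ≠ m) (X Y : Matrix (Fin 2) (Fin 2) ℂ)
    (s t : Fin N → Fin 2) : (siteOp n X * siteOp m Y) s t =
      if ∀ k, k ≠ n → k ≠ m → s k = t k then X (s n) (t n) * Y (s m) (t m) else 0 := by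
  rw [Matrix.mul_apply, Finset.sum_eq_single (Function.update s n (t n))]
  · simp only [siteOp, Matrix.of_apply, Function.update_self, Function.update_of_ne hnm.symm]
    rw [if_pos fun k hk => by rw [Function.update_of_ne hk]]
    have : (∀ k, k ≠ m → Function.update s n (t n) k = t k) ↔
        ∀ k, k ≠ n → k ≠ m → s k = t k := by
      refine ⟨fun h k hn hm => ?_, fun h k hm => ?_⟩
      · rw [← h k hm, Function.update_of_ne hn]
      · by_cases hk : k = n
        · subst hk; simp
        · rw [Function.update_of_ne hk, h k hk hm]
    rw [if_congr this rfl rfl, mul_ite, mul_zero]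
  · intro r _ hr
    simp only [siteOp, Matrix.of_apply]
    split_ifs with h₁ h₂
    · exact absurd (by rw [← h₂ n hnm, update_apply_eq_of_agree h₁]) hr
    all_goals simp
  · simp

lemma commute_siteOp {n m : Fin N} (hnm : n ≠ m) (X Y : Matrix (Fin 2) (Fin 2) ℂ) :
    Commute (siteOp n X) (siteOp m Y) := by
  ext s t
  rw [siteOp_mul_siteOp_apply hnm, siteOp_mul_siteOp_apply hnm.symm, mul_comm (Y _ _)]
  exact if_congr ⟨fun h k a b => h k b a, fun h k a b => h k b a⟩ rfl rfl

end SiteOperators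

/-! ### Two copies of the auxiliary space -/

section TwoCopies

variable {S : Type*} [Semiring S]

/-- `X ⊗ 1` on two copies of the auxiliary space. -/
def auxFst (X : Matrix (Fin 2) (Fin 2) S) : Matrix (Fin 2 × Fin 2) (Fin 2 × Fin 2) S :=
  Matrix.of fun p q => if p.2 = q.2 then X p.1 q.1 else 0

/-- `1 ⊗ X` on two copies of the auxiliary space. -/
def auxSnd (X : Matrix (Fin 2) (Fin 2) S) : Matrix (Fin 2 × Fin 2) (Fin 2 × Fin 2) S :=
  Matrix.of fun p q => if p.1 = q.1 then X p.2 q.2 else 0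

lemma auxFst_mul (X Y : Matrix (Fin 2) (Fin 2) S) : auxFst (X * Y) = auxFst X * auxFst Y := by
  ext1 p q
  simp [auxFst, Matrix.mul_apply, Fintype.sum_prod_type, Finset.sum_ite_irrel, ite_mul,
    mul_ite]

lemma auxSnd_mul (X Y : Matrix (Fin 2) (Fin 2) S) : auxSnd (X * Y) = auxSnd X * auxSnd Y := by
  ext1 p q
  simp [auxSnd, Matrix.mul_apply, Fintype.sum_prod_type_right, Finset.sum_ite_irrel,
    ite_mul, mul_ite]

lemma auxFst_mul_auxSnd_apply (X Y : Matrix (Fin 2) (Fin 2) S) (p q : Fin 2 × Fin 2) :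
    (auxFst X * auxSnd Y) p q = X p.1 q.1 * Y p.2 q.2 := by
  simp [auxFst, auxSnd, Matrix.mul_apply, Fintype.sum_prod_type, ite_mul, mul_ite]

lemma auxSnd_mul_auxFst_apply (X Y : Matrix (Fin 2) (Fin 2) S) (p q : Fin 2 × Fin 2) :
    (auxSnd Y * auxFst X) p q = Y p.2 q.2 * X p.1 q.1 := by
  simp [auxFst, auxSnd, Matrix.mul_apply, Fintype.sum_prod_type, ite_mul, mul_ite]

lemma auxFst_commute_auxSnd {X Y : Matrix (Fin 2) (Fin 2) S} (h : ∀ i k j l, Commute (X i k) (Y j l)) :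
    auxFst X * auxSnd Y = auxSnd Y * auxFst X := by
  ext1 p q
  rw [auxFst_mul_auxSnd_apply, auxSnd_mul_auxFst_apply, (h _ _ _ _).eq]

/-- The transpose acts on the auxiliary indices only and leaves the order of the operator entries;
reversing the product therefore needs their commutation. -/
lemma transpose_mul_of_commute {X Y : Matrix (Fin 2) (Fin 2) S} (h : ∀ i k j l, Commute (X i k) (Y j l)) :
    (X * Y)ᵀ = Yᵀ * Xᵀ := by
  ext1 i j
  simp only [Matrix.transpose_apply, Matrix.mul_apply]
  exact Finset.sum_congr rfl fun k _ => (h _ _ _ _).eq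

end TwoCopies

end EightVertex

end

noncomputable section

namespace EightVertex

/-! ### The `L`-operator -/

section Lax

/-- The entry of the eight-vertex `R`-matrix with row `(i, j)` and column `(k, l)`, as a function of
`i, k, j, l`. -/
def eightVertexEntry (a b c d : ℂ) : Fin 2 → Fin 2 → Fin 2 → Fin 2 → ℂ
  | 0, 0, 0, 0 => a | 0, 0, 0, 1 => 0 | 0, 0, 1, 0 => 0 | 0, 0, 1, 1 => b
  | 0, 1, 0, 0 => 0 | 0, 1, 0, 1 => d | 0, 1, 1, 0 => c | 0, 1, 1, 1 => 0
  | 1, 0, 0, 0 => 0 | 1, 0, 0, 1 => c | 1, 0, 1, 0 => d | 1, 0, 1, 1 => 0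
  | 1, 1, 0, 0 => b | 1, 1, 0, 1 => 0 | 1, 1, 1, 0 => 0 | 1, 1, 1, 1 => a

/-- Conservation of parity kills half of the 64 components; each of the others is trivial or one of
the six relations up to sign. -/
lemma eightVertexEntry_yangBaxter (a b c d a' b' c' d' a'' b'' c'' d'' : ℂ)
    (h₁ : a * a' * d'' + d * c' * a'' = b * b' * d'' + c * d' * a'')
    (h₂ : a * b' * c'' + d * d' * b'' = b * a' * c'' + c * c' * b'')
    (h₃ : a * c' * a'' + d * a' * d'' = b * c' * b'' + c * a' * c'')
    (h₄ : a * c' * d'' + d * a' * a'' = d * b' * b'' + a * d' * c'')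
    (h₅ : a * d' * b'' + d * b' * c'' = c * b' * d'' + b * d' * a'')
    (h₆ : b * d' * d'' + c * b' * a'' = c * a' * b'' + b * c' * c'')
    (i j k l s t : Fin 2) :
    ∑ r₁, ∑ r₂, eightVertexEntry a b c d i r₁ j r₂ *
        ∑ x, eightVertexEntry a' b' c' d' r₁ k s x * eightVertexEntry a'' b'' c'' d'' r₂ l x t =
      ∑ r₁, ∑ r₂, eightVertexEntry a b c d r₁ k r₂ l *
        ∑ x, eightVertexEntry a'' b'' c'' d'' j r₂ s x * eightVertexEntry a' b' c' d' i r₁ x t := by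
  simp only [Fin.sum_univ_two]
  fin_cases i <;> fin_cases j <;> fin_cases k <;> fin_cases l <;> fin_cases s <;> fin_cases t <;>
    simp only [eightVertexEntry, mul_zero, zero_mul, add_zero, zero_add] <;>
    first
    | rfl
    | ring1
    | linear_combination h₁
    | linear_combination h₂
    | linear_combination h₃
    | linear_combination h₄
    | linear_combination h₅
    | linear_combination h₆
    | linear_combination -h₁
    | linear_combination -h₂
    | linear_combination -h₃
    | linear_combination -h₄
    | linear_combination -h₅
    | linear_combination -h₆

variable {N : ℕ} (P : Params N)

/-- The `R`-matrix as a matrix on the first factor with entries acting on the second one. -/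
def lax (x : ℂ) : Matrix (Fin 2) (Fin 2) (Matrix (Fin 2) (Fin 2) ℂ) :=
  Matrix.of fun i k => Matrix.of fun j l =>
    eightVertexEntry (coefA P x) (coefB P x) (coefC P x) (coefD P x) i k j l

lemma R8V_apply (x : ℂ) (i j k l : Fin 2) : R8V P x (i, j) (k, l) =
    eightVertexEntry (coefA P x) (coefB P x) (coefC P x) (coefD P x) i k j l := by
  fin_cases i <;> fin_cases j <;> fin_cases k <;> fin_cases l <;> rfl

lemma RSite_eq_map (n : Fin N) (x : ℂ) : RSite P n x = (lax P x).map (siteHom n) := by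
  ext1 i k
  simp only [RSite, Matrix.of_apply, Matrix.map_apply, siteHom_apply]
  congr 1
  ext j l
  exact R8V_apply P x i j k l

lemma map_algebraMap_map_siteHom {m : Type*} (n : Fin N) (A : Matrix m m ℂ) :
    (A.map (algebraMap ℂ (Matrix (Fin 2) (Fin 2) ℂ))).map (siteHom n) = scalarMat A := by
  ext1 i k
  exact (siteHom n).commutes _

lemma lax_yangBaxter {w u v : ℂ} (hω : 0 < P.ω.im) (hu : u = w + v) :
    (R8V P w).map (algebraMap ℂ (Matrix (Fin 2) (Fin 2) ℂ)) *
        (auxFst (lax P u) * auxSnd (lax P v)) =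
      auxSnd (lax P v) * auxFst (lax P u) *
        (R8V P w).map (algebraMap ℂ (Matrix (Fin 2) (Fin 2) ℂ)) := by
  have h := eightVertexEntry_yangBaxter _ _ _ _ _ _ _ _ _ _ _ _
    (yangBaxter_aad P hω hu) (yangBaxter_abc P hω hu) (yangBaxter_aca P hω hu)
    (yangBaxter_acd P hω hu) (yangBaxter_adb P hω hu) (yangBaxter_bdd P hω hu)
  ext1 ⟨i, j⟩ ⟨k, l⟩
  simp_rw [Matrix.mul_apply (N := auxFst _ * auxSnd _), Matrix.mul_apply (M := auxSnd _ * auxFst _),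
    auxFst_mul_auxSnd_apply, auxSnd_mul_auxFst_apply, Matrix.map_apply, ← Algebra.commutes,
    ← Algebra.smul_def, Fintype.sum_prod_type, R8V_apply]
  ext s t
  simp only [Matrix.sum_apply, Matrix.smul_apply, Matrix.mul_apply, smul_eq_mul, lax,
    Matrix.of_apply]
  exact h i j k l s t

lemma RSite_yangBaxter {w u v : ℂ} (hω : 0 < P.ω.im) (hu : u = w + v) (n : Fin N) :
    scalarMat (R8V P w) * (auxFst (RSite P n u) * auxSnd (RSite P n v)) =
      auxSnd (RSite P n v) * auxFst (RSite P n u) * scalarMat (R8V P w) := by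
  have h := congrArg (fun A => A.map (siteHom n)) (lax_yangBaxter P hω hu)
  simp only [Matrix.map_mul, map_algebraMap_map_siteHom] at h
  have e₁ (x : ℂ) : (auxFst (lax P x)).map (siteHom n) = auxFst (RSite P n x) := by
    ext1 p q
    simp only [auxFst, Matrix.map_apply, Matrix.of_apply, RSite_eq_map, apply_ite (siteHom n),
      map_zero]
  have e₂ (x : ℂ) : (auxSnd (lax P x)).map (siteHom n) = auxSnd (RSite P n x) := by
    ext1 p q
    simp only [auxSnd, Matrix.map_apply, Matrix.of_apply, RSite_eq_map, apply_ite (siteHom n),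
      map_zero]
  simpa only [e₁, e₂] using h

/-! ### Scalar relations behind the bulk quantum determinant. -/

section Unitarity

variable (hω : 0 < P.ω.im) (u : ℂ)
include hω

lemma th_mul_th_eq : th P (u + P.η) * th P (u - P.η) =
    4 * (theta1 (u + P.η) (2 * P.ω) * theta4 (u + P.η) (2 * P.ω)) *
      (theta1 (u - P.η) (2 * P.ω) * theta4 (u - P.η) (2 * P.ω)) / theta2 0 P.ω ^ 2 := by
  have h₂ := theta2_zero_ne_zero hω
  rw [eq_div_iff (pow_ne_zero 2 h₂)]
  have e₁ := theta1_mul_theta4_double P hω (u + P.η)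
  have e₂ := theta1_mul_theta4_double P hω (u - P.η)
  linear_combination (-th P (u - P.η) * theta2 0 P.ω) * e₁ -
    2 * (theta1 (u + P.η) (2 * P.ω) * theta4 (u + P.η) (2 * P.ω)) * e₂

lemma coefA_mul_coefB_sub : coefA P u * coefB P (u - P.η) - coefD P u * coefD P (u - P.η) =
    th P (u + P.η) * th P (u - P.η) := by
  have h₂ := theta2_zero_ne_zero hω
  have ht : 0 < (2 * P.ω).im := by simpa using hω
  have h₄ := theta4_zero_ne_zero ht
  have e := theta4_quartic ht (x := P.η) (y := u) (h := 0) (s := u + P.η) (d := u - P.η)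
    (add_zero _).symm (add_zero _).symm (by ring) rfl
  rw [th_mul_th_eq P hω]
  simp only [coefA, coefB, coefD, sub_add_cancel]
  field_simp
  linear_combination 4 * (theta1 (u + P.η) (2 * P.ω) * theta1 (u - P.η) (2 * P.ω)) * e

lemma coefB_mul_coefA_sub : coefB P u * coefA P (u - P.η) - coefC P u * coefC P (u - P.η) =
    th P (u + P.η) * th P (u - P.η) := by
  have h₂ := theta2_zero_ne_zero hω
  have ht : 0 < (2 * P.ω).im := by simpa using hω
  have h₄ := theta4_zero_ne_zero ht
  have e := theta1_quartic_pair ht (x := P.η) (y := u) (h := 0) (s := u + P.η) (d := u - P.η)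
    (add_zero _).symm (add_zero _).symm (by ring) rfl
  rw [th_mul_th_eq P hω]
  simp only [coefA, coefB, coefC, sub_add_cancel]
  field_simp
  linear_combination 4 * (theta4 (u + P.η) (2 * P.ω) * theta4 (u - P.η) (2 * P.ω)) * e

omit hω in
lemma coefA_mul_coefD_sub : coefA P u * coefD P (u - P.η) = coefD P u * coefB P (u - P.η) := by
  simp only [coefA, coefB, coefD, sub_add_cancel]
  ring

omit hω in
lemma coefB_mul_coefC_sub : coefB P u * coefC P (u - P.η) = coefC P u * coefA P (u - P.η) := by
  simp only [coefA, coefB, coefC, sub_add_cancel]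
  ring

end Unitarity

lemma sigmaY_apply_zero_zero : sigmaY 0 0 = 0 := rfl
lemma sigmaY_apply_zero_one : sigmaY 0 1 = -Complex.I := rfl
lemma sigmaY_apply_one_zero : sigmaY 1 0 = Complex.I := rfl
lemma sigmaY_apply_one_one : sigmaY 1 1 = 0 := rfl

lemma eightVertexEntry_qdet (a b c d a' b' c' d' q : ℂ) (h₁ : a * b' - d * d' = q)
    (h₂ : b * a' - c * c' = q) (h₃ : a * d' = d * b') (h₄ : b * c' = c * a') (i j s t : Fin 2) :
    ∑ l, ∑ x, ((∑ k, eightVertexEntry a b c d i k s x * sigmaY k l) *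
        eightVertexEntry a' b' c' d' j l x t) =
      q * sigmaY i j * (if s = t then 1 else 0) := by
  simp only [Fin.sum_univ_two]
  fin_cases i <;> fin_cases j <;> fin_cases s <;> fin_cases t <;>
    simp only [Fin.zero_eta, Fin.mk_one, eightVertexEntry, sigmaY_apply_zero_zero,
      sigmaY_apply_zero_one, sigmaY_apply_one_zero, sigmaY_apply_one_one, zero_ne_one, one_ne_zero, if_true, if_false,
      mul_zero, zero_mul, add_zero, zero_add] <;>
    first
    | rfl
    | ring1
    | linear_combination -Complex.I * h₁
    | linear_combination Complex.I * h₁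
    | linear_combination -Complex.I * h₂
    | linear_combination Complex.I * h₂
    | linear_combination -Complex.I * h₃
    | linear_combination Complex.I * h₃
    | linear_combination -Complex.I * h₄
    | linear_combination Complex.I * h₄

lemma eightVertexEntry_qdet_transpose (a b c d a' b' c' d' q : ℂ) (h₁ : a * b' - d * d' = q)
    (h₂ : b * a' - c * c' = q) (h₃ : a * d' = d * b') (h₄ : b * c' = c * a') (i j s t : Fin 2) :
    ∑ l, ∑ x, ((∑ k, eightVertexEntry a' b' c' d' k i s x * sigmaY k l) *
        eightVertexEntry a b c d l j x t) =
      q * sigmaY i j * (if s = t then 1 else 0) := by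
  simp only [Fin.sum_univ_two]
  fin_cases i <;> fin_cases j <;> fin_cases s <;> fin_cases t <;>
    simp only [Fin.zero_eta, Fin.mk_one, eightVertexEntry, sigmaY_apply_zero_zero,
      sigmaY_apply_zero_one, sigmaY_apply_one_zero, sigmaY_apply_one_one, zero_ne_one, one_ne_zero, if_true, if_false,
      mul_zero, zero_mul, add_zero, zero_add] <;>
    first
    | rfl
    | ring1
    | linear_combination -Complex.I * h₁
    | linear_combination Complex.I * h₁
    | linear_combination -Complex.I * h₂
    | linear_combination Complex.I * h₂
    | linear_combination -Complex.I * h₃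
    | linear_combination Complex.I * h₃
    | linear_combination -Complex.I * h₄
    | linear_combination Complex.I * h₄

/-- Crossing unitarity of the weights. The two nontrivial scalar relations are quartic identities
with h = 0. The outer transpose leaves the entries, which act on the site, untouched. -/
lemma lax_qdet (hω : 0 < P.ω.im) (u : ℂ) :
    lax P u * sigmaY.map (algebraMap ℂ (Matrix (Fin 2) (Fin 2) ℂ)) * (lax P (u - P.η))ᵀ =
      (th P (u + P.η) * th P (u - P.η)) •
        sigmaY.map (algebraMap ℂ (Matrix (Fin 2) (Fin 2) ℂ)) := by
  have h := eightVertexEntry_qdet _ _ _ _ _ _ _ _ _ (coefA_mul_coefB_sub P hω u)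
    (coefB_mul_coefA_sub P hω u) (coefA_mul_coefD_sub P u) (coefB_mul_coefC_sub P u)
  ext i j s t
  simp_rw [Matrix.mul_apply, Matrix.smul_apply, Matrix.transpose_apply, Matrix.map_apply,
    ← Algebra.commutes, ← Algebra.smul_def, Algebra.algebraMap_eq_smul_one, Matrix.sum_apply,
    Matrix.mul_apply, Matrix.sum_apply, Matrix.smul_apply, lax, Matrix.of_apply, smul_eq_mul,
    ← mul_assoc, mul_comm (sigmaY _ _) (eightVertexEntry _ _ _ _ _ _ _ _), Matrix.one_apply]
  exact h i j s t

lemma lax_qdet_transpose (hω : 0 < P.ω.im) (u : ℂ) :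
    (lax P (u - P.η))ᵀ * sigmaY.map (algebraMap ℂ (Matrix (Fin 2) (Fin 2) ℂ)) * lax P u =
      (th P (u + P.η) * th P (u - P.η)) •
        sigmaY.map (algebraMap ℂ (Matrix (Fin 2) (Fin 2) ℂ)) := by
  have h := eightVertexEntry_qdet_transpose _ _ _ _ _ _ _ _ _ (coefA_mul_coefB_sub P hω u)
    (coefB_mul_coefA_sub P hω u) (coefA_mul_coefD_sub P u) (coefB_mul_coefC_sub P u)
  ext i j s t
  simp_rw [Matrix.mul_apply, Matrix.smul_apply, Matrix.transpose_apply, Matrix.map_apply,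
    ← Algebra.commutes, ← Algebra.smul_def, Algebra.algebraMap_eq_smul_one, Matrix.sum_apply,
    Matrix.mul_apply, Matrix.sum_apply, Matrix.smul_apply, lax, Matrix.of_apply, smul_eq_mul,
    ← mul_assoc, mul_comm (sigmaY _ _) (eightVertexEntry _ _ _ _ _ _ _ _), Matrix.one_apply]
  exact h i j s t

lemma RSite_qdet (hω : 0 < P.ω.im) (n : Fin N) (u : ℂ) :
    RSite P n u * scalarMat sigmaY * (RSite P n (u - P.η))ᵀ =
      (th P (u + P.η) * th P (u - P.η)) • scalarMat sigmaY := by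
  have h := congrArg (fun A => A.map (siteHom n)) (lax_qdet P hω u)
  simp only [Matrix.map_mul, map_algebraMap_map_siteHom] at h
  rw [RSite_eq_map, RSite_eq_map, ← Matrix.transpose_map, h, ← map_algebraMap_map_siteHom n]
  ext1 i j
  simp only [Matrix.map_apply, Matrix.smul_apply, map_smul]

lemma RSite_qdet_transpose (hω : 0 < P.ω.im) (n : Fin N) (u : ℂ) :
    (RSite P n (u - P.η))ᵀ * scalarMat sigmaY * RSite P n u =
      (th P (u + P.η) * th P (u - P.η)) • scalarMat sigmaY := by
  have h := congrArg (fun A => A.map (siteHom n)) (lax_qdet_transpose P hω u)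
  simp only [Matrix.map_mul, map_algebraMap_map_siteHom] at h
  rw [RSite_eq_map, RSite_eq_map, ← Matrix.transpose_map, h, ← map_algebraMap_map_siteHom n]
  ext1 i j
  simp only [Matrix.map_apply, Matrix.smul_apply, map_smul]

end Lax

end EightVertex

end

noncomputable section

namespace EightVertex

/-! ### The monodromy matrices -/

section Monodromy

variable {N : ℕ} (P : Params N)

/-- The ordered product of the `L`-operators over a list of sites. -/
def listM (l : List (Fin N)) (x : ℂ) : AuxOp N :=
  (l.map fun n => RSite P n (x - P.ξ n - P.η / 2)).prod

lemma bulkM_eq_listM (x : ℂ) : bulkM P x = listM P (List.finRange N).reverse x := rfl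

lemma listM_cons (n : Fin N) (l : List (Fin N)) (x : ℂ) :
    listM P (n :: l) x = RSite P n (x - P.ξ n - P.η / 2) * listM P l x := by
  simp [listM]

lemma commute_listM {n : Fin N} {l : List (Fin N)} (h : n ∉ l) (u x : ℂ) (i k j m : Fin 2) :
    Commute (RSite P n u i k) (listM P l x j m) := by
  induction l generalizing j m with
  | nil =>
    simp only [listM, List.map_nil, List.prod_nil, Matrix.one_apply]
    split_ifs
    · exact Commute.one_right _
    · exact Commute.zero_right _
  | cons n' l ih =>
    rw [List.mem_cons, not_or] at h
    rw [listM_cons, Matrix.mul_apply]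
    exact Commute.sum_right _ _ _ fun c _ => (commute_siteOp h.1 _ _).mul_right (ih h.2 c m)

/-- The list has no repetition, so L-operators of different sites have commuting entries and R can
be carried through one site at a time. The inhomogeneities shift u and v equally and leave w
unchanged. -/
lemma listM_yangBaxter (hω : 0 < P.ω.im) {w u v : ℂ} (hu : u = w + v) {l : List (Fin N)}
    (hl : l.Nodup) : scalarMat (R8V P w) * (auxFst (listM P l u) * auxSnd (listM P l v)) =
      auxSnd (listM P l v) * auxFst (listM P l u) * scalarMat (R8V P w) := by
  induction l with
  | nil =>
    have h₁ : auxFst (1 : AuxOp N) = 1 := by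
      ext1 p q
      simp only [auxFst, Matrix.of_apply, Matrix.one_apply, Prod.ext_iff]
      split_ifs <;> simp_all
    have h₂ : auxSnd (1 : AuxOp N) = 1 := by
      ext1 p q
      simp only [auxSnd, Matrix.of_apply, Matrix.one_apply, Prod.ext_iff]
      split_ifs <;> simp_all
    simp [listM, h₁, h₂]
  | cons n l ih =>
    rw [List.nodup_cons] at hl
    have h := RSite_yangBaxter P (u := u - P.ξ n - P.η / 2) (v := v - P.ξ n - P.η / 2) hω
      (by rw [hu]; ring) n (w := w)
    have c₁ := auxFst_commute_auxSnd (X := listM P l u) (Y := RSite P n (v - P.ξ n - P.η / 2))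
      fun i k j m => (commute_listM P hl.1 _ _ j m i k).symm
    have c₂ := auxFst_commute_auxSnd (X := RSite P n (u - P.ξ n - P.η / 2)) (Y := listM P l v)
      fun i k j m => commute_listM P hl.1 _ _ i k j m
    have ih := ih hl.2
    simp only [listM_cons, auxFst_mul, auxSnd_mul]
    generalize scalarMat (R8V P w) = R at *
    generalize auxFst (RSite P n (u - P.ξ n - P.η / 2)) = L₁ at *
    generalize auxSnd (RSite P n (v - P.ξ n - P.η / 2)) = L₂ at *
    generalize auxFst (listM P l u) = M₁ at *
    generalize auxSnd (listM P l v) = M₂ at *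
    calc R * (L₁ * M₁ * (L₂ * M₂)) = R * (L₁ * (M₁ * L₂) * M₂) := by simp only [mul_assoc]
      _ = R * (L₁ * L₂) * (M₁ * M₂) := by rw [c₁]; simp only [mul_assoc]
      _ = L₂ * L₁ * (R * (M₁ * M₂)) := by rw [h]; simp only [mul_assoc]
      _ = L₂ * (L₁ * M₂) * (M₁ * R) := by rw [ih]; simp only [mul_assoc]
      _ = _ := by rw [c₂]; simp only [mul_assoc]

/-- Scalars are central among the operators on the auxiliary space. -/
lemma scalarMat_mul_scalarMat {m : Type*} [Fintype m] (A B : Matrix m m ℂ) :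
    scalarMat (N := N) A * scalarMat B = scalarMat (A * B) :=
  (Matrix.map_mul (f := algebraMap ℂ (Op N))).symm

lemma scalarMat_smul {m n : Type*} (c : ℂ) (A : Matrix m n ℂ) :
    scalarMat (N := N) (c • A) = c • scalarMat A := by
  ext1 i j
  simp [scalarMat, Algebra.smul_def]

lemma scalarMat_one {m : Type*} [DecidableEq m] : scalarMat (N := N) (1 : Matrix m m ℂ) = 1 :=
  Matrix.map_one _ (map_zero _) (map_one _)

lemma sigmaY_mul_sigmaY : sigmaY * sigmaY = 1 := by
  ext i j
  fin_cases i <;> fin_cases j <;> simp [sigmaY]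

/-- The transposed product has its sites in reverse order, so the sites collapse in pairs around σʸ,
the tail of the list first. In the transposed version below the head site is innermost and collapses
first. -/
lemma listM_qdet (hω : 0 < P.ω.im) (x : ℂ) {l : List (Fin N)} (hl : l.Nodup) :
    listM P l (x + P.η / 2) * scalarMat sigmaY * (listM P l (x - P.η / 2))ᵀ =
      (l.map fun n => th P (x - P.ξ n + P.η) * th P (x - P.ξ n - P.η)).prod •
        scalarMat sigmaY := by
  induction l with
  | nil => simp [listM]
  | cons n l ih =>
    rw [List.nodup_cons] at hl
    have h := RSite_qdet P hω n (x - P.ξ n)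
    rw [listM_cons, listM_cons, transpose_mul_of_commute fun i k j m =>
      commute_listM P hl.1 _ _ i k j m, List.map_cons, List.prod_cons,
      show x + P.η / 2 - P.ξ n - P.η / 2 = x - P.ξ n by ring,
      show x - P.η / 2 - P.ξ n - P.η / 2 = x - P.ξ n - P.η by ring]
    calc _ = RSite P n (x - P.ξ n) * (listM P l (x + P.η / 2) * scalarMat sigmaY *
          (listM P l (x - P.η / 2))ᵀ) * (RSite P n (x - P.ξ n - P.η))ᵀ := by simp only [mul_assoc]
      _ = _ := by
        rw [ih hl.2, mul_smul_comm, smul_mul_assoc, h, smul_smul, mul_comm (List.prod _)]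

lemma listM_qdet_transpose (hω : 0 < P.ω.im) (x : ℂ) {l : List (Fin N)} (hl : l.Nodup) :
    (listM P l (x - P.η / 2))ᵀ * scalarMat sigmaY * listM P l (x + P.η / 2) =
      (l.map fun n => th P (x - P.ξ n + P.η) * th P (x - P.ξ n - P.η)).prod •
        scalarMat sigmaY := by
  induction l with
  | nil => simp [listM]
  | cons n l ih =>
    rw [List.nodup_cons] at hl
    have h := RSite_qdet_transpose P hω n (x - P.ξ n)
    rw [listM_cons, listM_cons, transpose_mul_of_commute fun i k j m =>
      commute_listM P hl.1 _ _ i k j m, List.map_cons, List.prod_cons,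
      show x + P.η / 2 - P.ξ n - P.η / 2 = x - P.ξ n by ring,
      show x - P.η / 2 - P.ξ n - P.η / 2 = x - P.ξ n - P.η by ring]
    calc _ = (listM P l (x - P.η / 2))ᵀ * ((RSite P n (x - P.ξ n - P.η))ᵀ * scalarMat sigmaY *
          RSite P n (x - P.ξ n)) * listM P l (x + P.η / 2) := by simp only [mul_assoc]
      _ = _ := by
        rw [h, mul_smul_comm, smul_mul_assoc, ih hl.2, smul_smul]

lemma qdetM_eq_list_prod (x : ℂ) : ((List.finRange N).reverse.map fun n =>
    th P (x - P.ξ n + P.η) * th P (x - P.ξ n - P.η)).prod = qdetM P x := by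
  rw [List.map_reverse, List.prod_reverse, ← List.ofFn_eq_map, List.prod_ofFn,
    Finset.prod_mul_distrib, qdetM, bulkEigD, bulkEigA, bulkEigA]
  congr 1 <;> refine Finset.prod_congr rfl fun n _ => ?_ <;> congr 1 <;> ring

lemma bulkM_mul_bulkMhat (hω : 0 < P.ω.im) (x : ℂ) :
    bulkM P (x + P.η / 2) * bulkMhat P (P.η / 2 - x) = ((-1) ^ N * qdetM P x) • 1 := by
  have h := listM_qdet P hω x (List.nodup_reverse.2 (List.nodup_finRange N))
  rw [← bulkM_eq_listM, ← bulkM_eq_listM, qdetM_eq_list_prod] at h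
  rw [bulkMhat, neg_sub, mul_smul_comm, ← mul_assoc, ← mul_assoc, h, smul_mul_assoc,
    scalarMat_mul_scalarMat, sigmaY_mul_sigmaY, scalarMat_one, smul_smul]

lemma bulkMhat_mul_bulkM (hω : 0 < P.ω.im) (x : ℂ) :
    bulkMhat P (x + P.η / 2) * bulkM P (P.η / 2 - x) = ((-1) ^ N * qdetM P (-x)) • 1 := by
  have h := listM_qdet_transpose P hω (-x) (List.nodup_reverse.2 (List.nodup_finRange N))
  rw [← bulkM_eq_listM, ← bulkM_eq_listM, qdetM_eq_list_prod] at h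
  rw [bulkMhat, smul_mul_assoc, mul_assoc, mul_assoc, ← mul_assoc _ (scalarMat sigmaY),
    show -(x + P.η / 2) = -x - P.η / 2 by ring, show P.η / 2 - x = -x + P.η / 2 by ring, h,
    mul_smul_comm, scalarMat_mul_scalarMat, sigmaY_mul_sigmaY, scalarMat_one, smul_smul]

lemma Kmat_neg_zero_one (x : ℂ) : Kmat P (-x) 0 1 = -Kmat P x 0 1 := by
  simp [Kmat, theta1_neg, theta4_neg]; ring

lemma Kmat_neg_one_zero (x : ℂ) : Kmat P (-x) 1 0 = -Kmat P x 1 0 := by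
  simp [Kmat, theta1_neg, theta4_neg]; ring

/-- The value of `K(x) K(-x)`. -/
def Kunit (x : ℂ) : ℂ := Kmat P x 0 0 * Kmat P (-x) 0 0 + Kmat P x 0 1 * Kmat P (-x) 1 0

lemma Kunit_neg (x : ℂ) : Kunit P (-x) = Kunit P x := by
  rw [Kunit, Kunit, neg_neg, Kmat_neg_zero_one, Kmat_neg_one_zero]; ring

/-- Changing the sign of x exchanges the diagonal entries and negates the others: K(-x) is the
adjugate of K(x). -/
lemma Kmat_mul_Kmat_neg (x : ℂ) : Kmat P x * Kmat P (-x) = Kunit P x • 1 := by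
  have h₁ := Kmat_neg_zero_one P x
  have h₂ := Kmat_neg_one_zero P x
  have h₃ : Kmat P (-x) 0 0 = Kmat P x 1 1 := by
    simp [Kmat]; ring
  have h₄ : Kmat P (-x) 1 1 = Kmat P x 0 0 := by
    simp [Kmat]; ring
  rw [Kunit]
  ext i j
  rw [Matrix.mul_apply, Fin.sum_univ_two]
  fin_cases i <;> fin_cases j <;>
    simp only [Fin.zero_eta, Fin.mk_one, h₁, h₂, h₃, h₄, Matrix.smul_apply, Matrix.one_apply_eq,
      smul_eq_mul, Matrix.one_apply_ne zero_ne_one, Matrix.one_apply_ne one_ne_zero] <;> ring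

/-- In M K M̂ · M K M̂ the inner M̂ M is a scalar, then K(x) K(-x), then the outer M M̂. The two
signs (-1)ᴺ cancel. -/
lemma Uminus_mul_Uminus (hω : 0 < P.ω.im) (x : ℂ) :
    Uminus P (x + P.η / 2) * Uminus P (P.η / 2 - x) =
      (Kunit P x * qdetM P x * qdetM P (-x)) • 1 := by
  have h₁ := bulkM_mul_bulkMhat P hω x
  have h₂ := bulkMhat_mul_bulkM P hω x
  have k₁ : Kminus P (x + P.η / 2) = Kmat P x := by rw [Kminus, add_sub_cancel_right]
  have k₂ : Kminus P (P.η / 2 - x) = Kmat P (-x) := by rw [Kminus]; congr 1; ring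
  rw [Uminus, Uminus, k₁, k₂]
  calc _ = bulkM P (x + P.η / 2) * scalarMat (Kmat P x) *
        (bulkMhat P (x + P.η / 2) * bulkM P (P.η / 2 - x)) * scalarMat (Kmat P (-x)) *
          bulkMhat P (P.η / 2 - x) := by simp only [mul_assoc]
    _ = ((-1) ^ N * qdetM P (-x)) • (bulkM P (x + P.η / 2) * (scalarMat (Kmat P x) *
        scalarMat (Kmat P (-x))) * bulkMhat P (P.η / 2 - x)) := by
      rw [h₂]; simp only [mul_assoc, mul_smul_comm, smul_mul_assoc, one_mul]
    _ = _ := by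
      rw [scalarMat_mul_scalarMat, Kmat_mul_Kmat_neg, scalarMat_smul, scalarMat_one,
        mul_smul_comm, smul_mul_assoc, mul_one, h₁, smul_smul, smul_smul]
      congr 1
      have : ((-1 : ℂ) ^ N) * (-1) ^ N = 1 := by rw [← mul_pow]; simp
      linear_combination (Kunit P x * qdetM P x * qdetM P (-x)) * this

end Monodromy

end EightVertex

end

noncomputable section

namespace EightVertex

section Parity

variable {N : ℕ} (P : Params N)

/-! ### The parity property of the boundary matrix -/

section BoundaryMatrix

variable (hω : 0 < P.ω.im) (y : ℂ)
include hω

lemma Kmat_diag_add : Kmat P y 0 0 + Kmat P y 1 1 =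
    theta4 P.ζ (2 * P.ω) / theta1 P.ζ (2 * P.ω) * (theta1 P.ζ P.ω * theta2 y P.ω) := by
  rw [theta1_mul_theta2 _ _ hω, add_comm P.ζ y]
  simp only [Kmat, Matrix.of_apply, Matrix.cons_val', Matrix.cons_val_zero, Matrix.cons_val_one,
    Matrix.cons_val_fin_one, neg_add_eq_sub]
  ring

lemma Kmat_diag_sub : Kmat P y 0 0 - Kmat P y 1 1 =
    theta4 P.ζ (2 * P.ω) / theta1 P.ζ (2 * P.ω) * (theta1 y P.ω * theta2 P.ζ P.ω) := by
  rw [theta1_mul_theta2 _ _ hω, ← neg_sub P.ζ y, theta1_neg, theta4_neg]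
  simp only [Kmat, Matrix.of_apply, Matrix.cons_val', Matrix.cons_val_zero, Matrix.cons_val_one,
    Matrix.cons_val_fin_one, neg_add_eq_sub]
  ring

variable {y} (hζ : theta1 P.ζ (2 * P.ω) ≠ 0) (hy : theta4 (2 * y) (2 * P.ω) ≠ 0)
include hζ hy

/-- The exponentials combine so that e^τ + e^(-τ) multiplies θ₄(y|2ω)² - θ₁(y|2ω)² = θ₃(y|ω)
θ₄(0|ω). The denominator θ₄(2y|2ω) is proportional to θ₃(y|ω) θ₄(y|ω), so one factor cancels and the
other is kept on the left. -/
lemma Kmat_antidiag_add : theta4 y P.ω * (Kmat P y 0 1 + Kmat P y 1 0) =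
    P.κ * (Complex.exp P.τ + Complex.exp (-P.τ)) * theta4 P.ζ (2 * P.ω) ^ 3 * theta4 0 P.ω /
      (theta1 P.ζ (2 * P.ω) * theta4 0 (2 * P.ω) ^ 2) * (theta1 y P.ω * theta2 y P.ω) := by
  have h₄ := theta4_zero_ne_zero (t := 2 * P.ω) (by simpa using hω)
  have e₁ := theta3_mul_theta4 y 0 hω
  rw [add_zero, sub_zero] at e₁
  have e₂ := theta4_two_mul_double P hω y
  have x₁ : Complex.exp P.τ * Complex.exp (-2 * P.τ) = Complex.exp (-P.τ) := by
    rw [← Complex.exp_add]; congr 1; ring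
  have x₂ : Complex.exp (-P.τ) * Complex.exp (2 * P.τ) = Complex.exp P.τ := by
    rw [← Complex.exp_add]; congr 1; ring
  rw [← theta1_two_mul_double P hω]
  simp only [Kmat, Matrix.of_apply, Matrix.cons_val', Matrix.cons_val_zero, Matrix.cons_val_one,
    Matrix.cons_val_fin_one]
  generalize Complex.exp P.τ = e at *
  generalize Complex.exp (-P.τ) = f at *
  generalize Complex.exp (-2 * P.τ) = g at *
  generalize Complex.exp (2 * P.τ) = h at *
  field_simp
  linear_combination P.κ * theta1 (2 * y) (2 * P.ω) * theta4 P.ζ (2 * P.ω) ^ 3 *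
    (-theta4 y P.ω * theta1 y (2 * P.ω) ^ 2 * (x₁ + x₂) - theta4 y P.ω * (e + f) * e₁ -
      (e + f) * theta4 0 P.ω * e₂)

lemma Kmat_antidiag_sub : theta3 y P.ω * (Kmat P y 0 1 - Kmat P y 1 0) =
    P.κ * (Complex.exp P.τ - Complex.exp (-P.τ)) * theta4 P.ζ (2 * P.ω) ^ 3 * theta3 0 P.ω /
      (theta1 P.ζ (2 * P.ω) * theta4 0 (2 * P.ω) ^ 2) * (theta1 y P.ω * theta2 y P.ω) := by
  have h₄ := theta4_zero_ne_zero (t := 2 * P.ω) (by simpa using hω)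
  have e₁ := theta4_mul_theta3 y 0 hω
  rw [add_zero, sub_zero] at e₁
  have e₂ := theta4_two_mul_double P hω y
  have x₁ : Complex.exp P.τ * Complex.exp (-2 * P.τ) = Complex.exp (-P.τ) := by
    rw [← Complex.exp_add]; congr 1; ring
  have x₂ : Complex.exp (-P.τ) * Complex.exp (2 * P.τ) = Complex.exp P.τ := by
    rw [← Complex.exp_add]; congr 1; ring
  rw [← theta1_two_mul_double P hω]
  simp only [Kmat, Matrix.of_apply, Matrix.cons_val', Matrix.cons_val_zero, Matrix.cons_val_one,
    Matrix.cons_val_fin_one]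
  generalize Complex.exp P.τ = e at *
  generalize Complex.exp (-P.τ) = f at *
  generalize Complex.exp (-2 * P.τ) = g at *
  generalize Complex.exp (2 * P.τ) = h at *
  field_simp
  linear_combination P.κ * theta1 (2 * y) (2 * P.ω) * theta4 P.ζ (2 * P.ω) ^ 3 *
    (-theta3 y P.ω * theta1 y (2 * P.ω) ^ 2 * (x₁ - x₂) - theta3 y P.ω * (e - f) * e₁ -
      (e - f) * theta3 0 P.ω * e₂)

end BoundaryMatrix

/-- The parity property of a two-by-two matrix depending on a spectral parameter, in terms of the
eigenvectors of the `R`-matrix; `U` and `U'` are its values at `x` and `-x`. -/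
structure ParityRelation (x : ℂ) (U U' : AuxOp N) : Prop where
  antidiag_add : (coefA P (2 * x) - coefD P (2 * x)) • (U 0 1 + U 1 0) =
    -(pfun P x • (U' 0 1 + U' 1 0))
  antidiag_sub : (coefA P (2 * x) + coefD P (2 * x)) • (U 0 1 - U 1 0) =
    -(pfun P x • (U' 0 1 - U' 1 0))
  diag_sub : (coefB P (2 * x) + coefC P (2 * x)) • (U 0 0 - U 1 1) =
    -(pfun P x • (U' 0 0 - U' 1 1))
  diag_add : (coefB P (2 * x) - coefC P (2 * x)) • (U 0 0 + U 1 1) =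
    pfun P x • (U' 0 0 + U' 1 1)

/-- The antisymmetric form on the auxiliary space. -/
def antisymmForm : Matrix (Fin 2) (Fin 2) ℂ := !![0, -1; 1, 0]

/-- A matrix on the auxiliary space as a vector in the tensor square of this space. -/
def flatten (U : AuxOp N) (p : Fin 2 × Fin 2) : Op N := (U * scalarMat antisymmForm : AuxOp N) p.1 p.2

lemma flatten_apply (U : AuxOp N) : flatten U (0, 0) = U 0 1 ∧ flatten U (0, 1) = -U 0 0 ∧
    flatten U (1, 0) = U 1 1 ∧ flatten U (1, 1) = -U 1 0 := by
  simp [flatten, Matrix.mul_apply, scalarMat, antisymmForm]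

lemma R8V_mulVec_apply (x : ℂ) (V : Fin 2 × Fin 2 → Op N) :
    (scalarMat (R8V P x) *ᵥ V) (0, 0) = coefA P x • V (0, 0) + coefD P x • V (1, 1) ∧
    (scalarMat (R8V P x) *ᵥ V) (0, 1) = coefB P x • V (0, 1) + coefC P x • V (1, 0) ∧
    (scalarMat (R8V P x) *ᵥ V) (1, 0) = coefC P x • V (0, 1) + coefB P x • V (1, 0) ∧
    (scalarMat (R8V P x) *ᵥ V) (1, 1) = coefD P x • V (0, 0) + coefA P x • V (1, 1) := by
  simp [Matrix.mulVec, dotProduct, Fintype.sum_prod_type, scalarMat, R8V_apply, eightVertexEntry,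
    Algebra.smul_def]

/-- The four components of the parity relation are the projections of one vector equation on the
eigenvectors e₀₀ ∓ e₁₁ and e₀₁ ± e₁₀ of R. Their signs come from J and from the flip, under which
e₀₁ - e₁₀ is odd. -/
lemma parityRelation_iff (x : ℂ) (U U' : AuxOp N) : ParityRelation P x U U' ↔
    scalarMat (R8V P (2 * x)) *ᵥ flatten U = (-pfun P x) • (flatten U' ∘ Prod.swap) := by
  obtain ⟨r₁, r₂, r₃, r₄⟩ := R8V_mulVec_apply P (2 * x) (flatten U)
  obtain ⟨u₁, u₂, u₃, u₄⟩ := flatten_apply U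
  obtain ⟨v₁, v₂, v₃, v₄⟩ := flatten_apply U'
  rw [u₁, u₄] at r₁ r₄
  rw [u₂, u₃] at r₂ r₃
  constructor
  · rintro ⟨h₁, h₂, h₃, h₄⟩
    funext ⟨i, j⟩
    fin_cases i <;> fin_cases j <;>
      simp only [Fin.zero_eta, Fin.mk_one, r₁, r₂, r₃, r₄, Pi.smul_apply, Function.comp_apply,
        Prod.swap_prod_mk, v₁, v₂, v₃, v₄]
    · linear_combination (norm := module) (1 / 2 : ℂ) • h₁ + (1 / 2 : ℂ) • h₂
    · linear_combination (norm := module) (-(1 / 2) : ℂ) • h₃ - (1 / 2 : ℂ) • h₄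
    · linear_combination (norm := module) (-(1 / 2) : ℂ) • h₃ + (1 / 2 : ℂ) • h₄
    · linear_combination (norm := module) (-(1 / 2) : ℂ) • h₁ + (1 / 2 : ℂ) • h₂
  · intro h
    have h₁ := congrFun h (0, 0)
    have h₂ := congrFun h (0, 1)
    have h₃ := congrFun h (1, 0)
    have h₄ := congrFun h (1, 1)
    simp only [r₁, r₂, r₃, r₄, Pi.smul_apply, Function.comp_apply, Prod.swap_prod_mk,
      v₁, v₂, v₃, v₄] at h₁ h₂ h₃ h₄
    constructor
    · linear_combination (norm := module) h₁ - h₄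
    · linear_combination (norm := module) h₁ + h₄
    · linear_combination (norm := module) -h₂ - h₃
    · linear_combination (norm := module) h₃ - h₂

/-- Multiplication by J removes the conjugation by σʸ in M̂ and leaves J M(-x)ᵗ on the right. Right
multiplication by a transpose is action on the second tensor factor. -/
lemma flatten_Uminus (x : ℂ) : flatten (Uminus P x) = (-1 : ℂ) ^ N •
    ((auxFst (bulkM P x) * auxSnd (bulkM P (-x))) *ᵥ flatten (scalarMat (Kminus P x))) := by
  have e₁ : sigmaY = Complex.I • antisymmForm := by
    ext i j; fin_cases i <;> fin_cases j <;> simp [sigmaY, antisymmForm]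
  have e₂ : sigmaY * antisymmForm = (-Complex.I) • 1 := by
    ext i j; fin_cases i <;> fin_cases j <;> simp [sigmaY, antisymmForm, Matrix.mul_apply]
  have e₃ : bulkMhat P x * scalarMat antisymmForm =
      (-1 : ℂ) ^ N • (scalarMat antisymmForm * (bulkM P (-x))ᵀ) := by
    rw [bulkMhat, smul_mul_assoc, mul_assoc, scalarMat_mul_scalarMat, e₂, e₁, scalarMat_smul,
      scalarMat_smul, scalarMat_one, mul_smul_comm, mul_one, smul_mul_assoc, smul_smul,
      smul_smul]
    congr 1
    linear_combination (-(-1 : ℂ) ^ N) * Complex.I_mul_I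
  funext ⟨i, j⟩
  simp only [flatten]
  rw [Uminus, mul_assoc, e₃, mul_smul_comm, mul_assoc, ← mul_assoc (scalarMat (Kminus P x)),
    scalarMat_mul_scalarMat, Matrix.smul_apply, Pi.smul_apply]
  congr 1
  simp only [Matrix.mulVec, dotProduct, auxFst_mul_auxSnd_apply, Fintype.sum_prod_type]
  rw [Matrix.mul_apply]
  refine Finset.sum_congr rfl fun k _ => ?_
  rw [Matrix.mul_apply, Finset.mul_sum]
  refine Finset.sum_congr rfl fun l _ => ?_
  rw [flatten, scalarMat_mul_scalarMat, mul_assoc, scalarMat, Matrix.map_apply, Algebra.commutes,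
    Matrix.transpose_apply]

lemma parityRelation_scalarMat {x : ℂ} {A B : Matrix (Fin 2) (Fin 2) ℂ}
    (h₁ : (coefA P (2 * x) - coefD P (2 * x)) * (A 0 1 + A 1 0) =
      -(pfun P x * (B 0 1 + B 1 0)))
    (h₂ : (coefA P (2 * x) + coefD P (2 * x)) * (A 0 1 - A 1 0) =
      -(pfun P x * (B 0 1 - B 1 0)))
    (h₃ : (coefB P (2 * x) + coefC P (2 * x)) * (A 0 0 - A 1 1) =
      -(pfun P x * (B 0 0 - B 1 1)))
    (h₄ : (coefB P (2 * x) - coefC P (2 * x)) * (A 0 0 + A 1 1) =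
      pfun P x * (B 0 0 + B 1 1)) :
    ParityRelation P x (scalarMat A : AuxOp N) (scalarMat B) := by
  constructor <;>
    simp only [scalarMat, Matrix.map_apply, ← map_add, ← map_sub, Algebra.smul_def, ← map_mul,
      ← map_neg, h₁, h₂, h₃, h₄]

/-- With y = x-η/2 and z = x+η/2 the matrices are K(y) and K(-z). Each eigencomponent of K is a
constant times θ₁, θ₂, θ₁θ₂/θ₄ or θ₁θ₂/θ₃, and multiplication by its eigenvalue turns the value at y
into p(x) times the value at z. -/
lemma parityRelation_Kminus (hω : 0 < P.ω.im) (hζ : theta1 P.ζ (2 * P.ω) ≠ 0) {x : ℂ}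
    (h₁ : theta4 (2 * x - P.η) (2 * P.ω) ≠ 0) (h₂ : theta4 (2 * x + P.η) (2 * P.ω) ≠ 0) :
    ParityRelation P x (scalarMat (Kminus P x) : AuxOp N) (scalarMat (Kminus P (-x))) := by
  have hy : theta4 (2 * (x - P.η / 2)) (2 * P.ω) ≠ 0 := by
    rwa [show 2 * (x - P.η / 2) = 2 * x - P.η by ring]
  have hz : theta4 (2 * -(x + P.η / 2)) (2 * P.ω) ≠ 0 := by
    rwa [show 2 * -(x + P.η / 2) = -(2 * x + P.η) by ring, theta4_neg]
  have a₁ := Kmat_antidiag_add P hω hζ hy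
  have a₂ := Kmat_antidiag_add P hω hζ hz
  have b₁ := Kmat_antidiag_sub P hω hζ hy
  have b₂ := Kmat_antidiag_sub P hω hζ hz
  have c₁ := Kmat_diag_add P hω (x - P.η / 2)
  have c₂ := Kmat_diag_add P hω (-(x + P.η / 2))
  have d₁ := Kmat_diag_sub P hω (x - P.η / 2)
  have d₂ := Kmat_diag_sub P hω (-(x + P.η / 2))
  have hu : 2 * x + P.η = 2 * (x + P.η / 2) := by ring
  have hu' : 2 * x = (x + P.η / 2) + (x - P.η / 2) := by ring
  have hp := pfun_eq P hω x
  have e : Kminus P (-x) = Kmat P (-(x + P.η / 2)) := by rw [Kminus]; congr 1; ring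
  have l₁ := coefA_sub_coefD P hω hu hu'
  have l₂ := coefA_add_coefD P hω hu hu'
  have l₃ := coefB_add_coefC P hω hu hu'
  have l₄ := coefB_sub_coefC P hω hu hu'
  rw [e, Kminus]
  generalize x - P.η / 2 = y at *
  generalize x + P.η / 2 = z at *
  simp only [theta1_neg, theta2_neg, theta3_neg, theta4_neg] at a₂ b₂ c₂ d₂
  apply parityRelation_scalarMat
  · rw [l₁, hp]
    linear_combination (weightConst P * (theta1 z P.ω * theta2 z P.ω * theta3 z P.ω)) * a₁ +
      weightConst P * theta3 z P.ω * (theta1 y P.ω * theta2 y P.ω) * a₂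
  · rw [l₂, hp]
    linear_combination (weightConst P * (theta1 z P.ω * theta2 z P.ω * theta4 z P.ω)) * b₁ +
      weightConst P * theta4 z P.ω * (theta1 y P.ω * theta2 y P.ω) * b₂
  · rw [l₃, hp, d₁, d₂]
    ring
  · rw [l₄, hp, c₁, c₂]
    ring

lemma parityRelation_Uminus_of_Kminus (hω : 0 < P.ω.im) {x : ℂ}
    (h : ParityRelation P x (scalarMat (Kminus P x)) (scalarMat (Kminus P (-x)))) :
    ParityRelation P x (Uminus P x) (Uminus P (-x)) := by
  rw [parityRelation_iff] at h ⊢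
  have hM := listM_yangBaxter P hω (w := 2 * x) (u := x) (v := -x) (by ring)
    (List.nodup_reverse.2 (List.nodup_finRange N))
  rw [← bulkM_eq_listM, ← bulkM_eq_listM] at hM
  -- Exchanging the two auxiliary copies turns M₂(-x) M₁(x) into M₁(-x) M₂(x), the product that
  -- belongs to 𝒰₋(-x).
  have hsw (f : Fin 2 × Fin 2 → Op N) :
      (auxSnd (bulkM P (-x)) * auxFst (bulkM P x)) *ᵥ (f ∘ Prod.swap) =
        ((auxFst (bulkM P (-x)) * auxSnd (bulkM P x)) *ᵥ f) ∘ Prod.swap := by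
    funext p
    simp only [Matrix.mulVec, dotProduct, Function.comp_apply, auxFst_mul_auxSnd_apply,
      auxSnd_mul_auxFst_apply]
    exact Fintype.sum_equiv (Equiv.prodComm _ _) _ _ fun q => rfl
  rw [flatten_Uminus, flatten_Uminus, neg_neg, Matrix.mulVec_smul, Matrix.mulVec_mulVec, hM,
    ← Matrix.mulVec_mulVec, h, Matrix.mulVec_smul, hsw, smul_comm]
  rfl

lemma R8V_neg_eta (hω : 0 < P.ω.im) : coefA P (-P.η) = 0 ∧ coefD P (-P.η) = 0 ∧
    coefB P (-P.η) = -th P P.η ∧ coefC P (-P.η) = th P P.η := by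
  have h₂ := theta2_zero_ne_zero hω
  have h₄ := theta4_zero_ne_zero (t := 2 * P.ω) (by simpa using hω)
  have e := theta1_mul_theta4_double P hω P.η
  simp only [coefA, coefB, coefC, coefD, neg_add_cancel, theta1_zero, theta1_neg, theta4_neg]
  refine ⟨by simp, by simp, ?_, ?_⟩
  · field_simp
    linear_combination -e
  · field_simp
    linear_combination e

/-- R(-η) is -2θ(η) times the projector on the singlet e₀₁ - e₁₀, so the partial trace picks out
exactly the combinations of entries in the parity relation; the prefactor removes θ(η). -/
lemma Utilde_eq (hω : 0 < P.ω.im) {x : ℂ} (hη : th P P.η ≠ 0)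
    (h : ParityRelation P x (Uminus P x) (Uminus P (-x))) :
    Utilde P x = pfun P x • Uminus P (-x) := by
  obtain ⟨h₁, h₂, h₃, h₄⟩ := h
  obtain ⟨a, d, b, c⟩ := R8V_neg_eta P hω
  ext1 i k
  rw [Utilde, Matrix.smul_apply, Matrix.smul_apply, ptrace2, Matrix.of_apply]
  generalize Uminus P x = U at *
  generalize Uminus P (-x) = U' at *
  have key (r : ℂ) (X : Op N) : (th P P.η)⁻¹ • r • th P P.η • X = r • X := by
    rw [smul_comm r, inv_smul_smul₀ hη]
  fin_cases i <;> fin_cases k <;>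
    simp [Fin.sum_univ_two, Matrix.mul_apply, Fintype.sum_prod_type, scalarMat, R8V21, R8V_apply,
      eightVertexEntry, a, b, c, d, Matrix.one_apply, Algebra.algebraMap_eq_smul_one, key]
  · linear_combination (norm := module) (1 / 2 : ℂ) • h₄ - (1 / 2 : ℂ) • h₃
  · linear_combination (norm := module) (-(1 / 2) : ℂ) • h₁ - (1 / 2 : ℂ) • h₂
  · linear_combination (norm := module) (-(1 / 2) : ℂ) • h₁ + (1 / 2 : ℂ) • h₂
  · linear_combination (norm := module) (1 / 2 : ℂ) • h₄ + (1 / 2 : ℂ) • h₃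

lemma parityRelation_Uminus (hω : 0 < P.ω.im) (hζ : theta1 P.ζ (2 * P.ω) ≠ 0) {x : ℂ}
    (h₁ : theta4 (2 * x - P.η) (2 * P.ω) ≠ 0) (h₂ : theta4 (2 * x + P.η) (2 * P.ω) ≠ 0) :
    ParityRelation P x (Uminus P x) (Uminus P (-x)) :=
  parityRelation_Uminus_of_Kminus P hω (parityRelation_Kminus P hω hζ h₁ h₂)

end Parity

end EightVertex

end

noncomputable section

namespace EightVertex

section Gauge

variable {N : ℕ} (P : Params N)

/-! ### The gauged generators -/

/-- The contraction of a two-by-two matrix with a pair of intertwining vectors whose arguments have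
the half sum `s` and the half difference `d`. -/
def gaugeForm (s d : ℂ) (U : AuxOp N) : Op N :=
  (theta3 s P.ω * theta3 d P.ω) • (U 0 1 - U 1 0) +
  (theta4 s P.ω * theta4 d P.ω) • (U 0 1 + U 1 0) +
  (theta1 s P.ω * theta1 d P.ω) • (U 0 0 + U 1 1) +
  (theta2 s P.ω * theta2 d P.ω) • (U 0 0 - U 1 1)

/-- The right side is the row (θ₃(m), -θ₂(m)) and the column (θ₂(n), θ₃(n)) contracted with U.
Passing to s and d diagonalises it in the eigenbasis of R. -/
lemma gaugeForm_eq (hω : 0 < P.ω.im) {s d m n : ℂ} (hm : m = s + d) (hn : n = s - d)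
    (U : AuxOp N) : gaugeForm P s d U =
      (2 * theta3 m (2 * P.ω) * theta2 n (2 * P.ω)) • U 0 0 +
      (2 * theta3 m (2 * P.ω) * theta3 n (2 * P.ω)) • U 0 1 -
      (2 * theta2 m (2 * P.ω) * theta2 n (2 * P.ω)) • U 1 0 -
      (2 * theta2 m (2 * P.ω) * theta3 n (2 * P.ω)) • U 1 1 := by
  rw [gaugeForm, theta3_mul_theta3 _ _ hω, theta4_mul_theta4 _ _ hω, theta1_mul_theta1 _ _ hω,
    theta2_mul_theta2 _ _ hω, ← hm, ← hn]
  module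

lemma scalarMat_conj_apply (A B : Matrix (Fin 2) (Fin 2) ℂ) (U : AuxOp N) (i j : Fin 2) :
    (scalarMat A * U * scalarMat B : AuxOp N) i j =
      (A i 0 * B 0 j) • U 0 0 + (A i 0 * B 1 j) • U 0 1 + (A i 1 * B 0 j) • U 1 0 +
        (A i 1 * B 1 j) • U 1 1 := by
  simp only [Matrix.mul_apply, Fin.sum_univ_two, scalarMat, Matrix.map_apply, ← Algebra.commutes,
    ← Algebra.smul_def]
  module

section Generators

variable (hω : 0 < P.ω.im) {x : ℂ} (hx : rfun P x ≠ 0) (b : ℂ)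
include hω hx

/-- The theta factor of `rfun` cancels the denominator of `GtilInv`. The other denominator is the
same on both sides and may vanish. Of the generators, 𝒜₋ and 𝒟₋ share s and differ in d, while ℬ₋
and 𝒞₋ share d and differ in s. -/
lemma genA_eq : genA P x b =
    (-(theta4 (2 * x - P.η) (2 * P.ω) / (2 * th P ((b - 2) * P.η)))) •
      gaugeForm P ((P.α + 1) * P.η) (x + P.η / 2 - (b - 1) * P.η) (Uminus P x) := by
  have hx' := right_ne_zero_of_mul hx
  rw [gaugeForm_eq P hω (m := x - P.η / 2 + (P.α - (b - 2 - 1)) * P.η)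
    (n := P.η / 2 - x + (P.α + (b - 2 + 1)) * P.η) (by ring) (by ring), genA, Ugauge,
    scalarMat_conj_apply, rfun]
  simp only [GtilInv, Gtil, Ytil, Xtil, Xvec, Yvec, Matrix.of_apply, Matrix.transpose_apply,
    Matrix.cons_val_zero, Matrix.cons_val_one, Pi.smul_apply, smul_eq_mul,
    show x - P.η / 2 + (P.α + 1) * P.η = x + (P.α + 1 / 2) * P.η by ring,
    show (1 + (b - 2 - 1)) * P.η = (b - 2) * P.η by ring]
  generalize th P (x + (P.α + 1 / 2) * P.η) = c at hx' ⊢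
  match_scalars <;> field_simp

lemma genB_eq : genB P x b =
    (-(theta4 (2 * x - P.η) (2 * P.ω) / (2 * th P (b * P.η)))) •
      gaugeForm P ((P.α - b + 1) * P.η) (x - P.η / 2) (Uminus P x) := by
  have hx' := right_ne_zero_of_mul hx
  rw [gaugeForm_eq P hω (m := x - P.η / 2 + (P.α - (b - 1)) * P.η)
    (n := P.η / 2 - x + (P.α - (b - 1)) * P.η) (by ring) (by ring), genB, Ugauge,
    scalarMat_conj_apply, rfun]
  simp only [GtilInv, Gtil, Ytil, Xtil, Xvec, Yvec, Matrix.of_apply, Matrix.transpose_apply,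
    Matrix.cons_val_zero, Matrix.cons_val_one, Pi.smul_apply, smul_eq_mul,
    show x - P.η / 2 + (P.α + 1) * P.η = x + (P.α + 1 / 2) * P.η by ring,
    show (1 + (b - 1)) * P.η = b * P.η by ring]
  generalize th P (x + (P.α + 1 / 2) * P.η) = c at hx' ⊢
  match_scalars <;> field_simp

lemma genC_eq : genC P x b =
    (theta4 (2 * x - P.η) (2 * P.ω) / (2 * th P ((b - 2) * P.η))) •
      gaugeForm P ((P.α + b - 1) * P.η) (x - P.η / 2) (Uminus P x) := by
  have hx' := right_ne_zero_of_mul hx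
  rw [gaugeForm_eq P hω (m := x - P.η / 2 + (P.α + (b - 2 + 1)) * P.η)
    (n := P.η / 2 - x + (P.α + (b - 2 + 1)) * P.η) (by ring) (by ring), genC, Ugauge,
    scalarMat_conj_apply, rfun]
  simp only [GtilInv, Gtil, Ytil, Xtil, Xvec, Yvec, Matrix.of_apply, Matrix.transpose_apply,
    Matrix.cons_val_zero, Matrix.cons_val_one, Pi.smul_apply, smul_eq_mul,
    show x - P.η / 2 + (P.α + 1) * P.η = x + (P.α + 1 / 2) * P.η by ring,
    show (b - 2 + 1 - 1) * P.η = (b - 2) * P.η by ring]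
  generalize th P (x + (P.α + 1 / 2) * P.η) = c at hx' ⊢
  match_scalars <;> field_simp

lemma genD_eq : genD P x b =
    (theta4 (2 * x - P.η) (2 * P.ω) / (2 * th P (b * P.η))) •
      gaugeForm P ((P.α + 1) * P.η) (x + P.η / 2 + (b - 1) * P.η) (Uminus P x) := by
  have hx' := right_ne_zero_of_mul hx
  rw [gaugeForm_eq P hω (m := x - P.η / 2 + (P.α + (b + 1)) * P.η)
    (n := P.η / 2 - x + (P.α - (b - 1)) * P.η) (by ring) (by ring), genD, Ugauge,
    scalarMat_conj_apply, rfun]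
  simp only [GtilInv, Gtil, Ytil, Xtil, Xvec, Yvec, Matrix.of_apply, Matrix.transpose_apply,
    Matrix.cons_val_zero, Matrix.cons_val_one, Pi.smul_apply, smul_eq_mul,
    show x - P.η / 2 + (P.α + 1) * P.η = x + (P.α + 1 / 2) * P.η by ring,
    show (b + 1 - 1) * P.η = b * P.η by ring]
  generalize th P (x + (P.α + 1 / 2) * P.η) = c at hx' ⊢
  match_scalars <;> field_simp

end Generators

/-! ### Parity relations for the gauge form. -/

section GaugeParity

variable (hω : 0 < P.ω.im) {x : ℂ} {U U' : AuxOp N} (h : ParityRelation P x U U') (s : ℂ)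
include hω h

/-- The eigenvalue with index j times θⱼ(x+η/2) is θ(2x+η) θⱼ(x-η/2), with the same prefactor for
every j. The component j = 1 enters the parity relation with the opposite sign, which the oddness of
θ₁ absorbs. -/
lemma pfun_smul_gaugeForm :
    pfun P x • gaugeForm P s (-(x + P.η / 2)) U' =
      (-th P (2 * x + P.η)) • gaugeForm P s (x - P.η / 2) U := by
  have hu : 2 * x + P.η = 2 * (x + P.η / 2) := by ring
  have hu' : 2 * x = (x + P.η / 2) + (x - P.η / 2) := by ring
  obtain ⟨h₁, h₂, h₃, h₄⟩ := h
  rw [coefA_sub_coefD P hω hu hu'] at h₁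
  rw [coefA_add_coefD P hω hu hu'] at h₂
  rw [coefB_add_coefC P hω hu hu'] at h₃
  rw [coefB_sub_coefC P hω hu hu'] at h₄
  rw [hu, ← th_two_mul P hω, gaugeForm, gaugeForm, theta1_neg, theta2_neg, theta3_neg, theta4_neg]
  generalize x - P.η / 2 = y at *
  generalize x + P.η / 2 = z at *
  linear_combination (norm := module)
    (theta3 s P.ω * theta3 z P.ω) • h₂ + (theta4 s P.ω * theta4 z P.ω) • h₁ +
    (theta1 s P.ω * theta1 z P.ω) • h₄ + (theta2 s P.ω * theta2 z P.ω) • h₃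

/-- The eigenvalue with index j times θⱼ(x-η/2-g) is not a single theta function of x; the
intertwining relations expand it in θⱼ(x+η/2±g), with coefficients independent of j. -/
lemma th_mul_pfun_smul_gaugeForm (g : ℂ) :
    (th P g * pfun P x) • gaugeForm P s (-(x - P.η / 2 - g)) U' =
      (th P P.η * th P (2 * x - g)) • gaugeForm P s (x + P.η / 2 + g) U -
      (th P (2 * x) * th P (g + P.η)) • gaugeForm P s (x + P.η / 2 - g) U := by
  have hu : 2 * x + P.η = 2 * (x + P.η / 2) := by ring
  have hu' : 2 * x = (x + P.η / 2) + (x - P.η / 2) := by ring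
  have e₁ := theta1_intertwining P hω (x - P.η / 2) (x + P.η / 2) g
  have e₂ := theta2_intertwining P hω (x - P.η / 2) (x + P.η / 2) g
  have e₃ := theta3_intertwining P hω (x - P.η / 2) (x + P.η / 2) g
  have e₄ := theta4_intertwining P hω (x - P.η / 2) (x + P.η / 2) g
  obtain ⟨h₁, h₂, h₃, h₄⟩ := h
  rw [← coefB_sub_coefC P hω hu hu'] at e₁
  rw [← coefB_add_coefC P hω hu hu'] at e₂
  rw [← coefA_add_coefD P hω hu hu'] at e₃
  rw [← coefA_sub_coefD P hω hu hu'] at e₄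
  rw [show x - P.η / 2 + (x + P.η / 2) - g = 2 * x - g by ring,
    show x - P.η / 2 + (x + P.η / 2) = 2 * x by ring,
    show g + (x + P.η / 2) - (x - P.η / 2) = g + P.η by ring,
    show x + P.η / 2 - (x - P.η / 2) = P.η by ring] at e₁ e₂ e₃ e₄
  rw [gaugeForm, gaugeForm, gaugeForm, theta1_neg, theta2_neg, theta3_neg, theta4_neg]
  linear_combination (norm := module)
    (th P g * theta3 s P.ω * theta3 (x - P.η / 2 - g) P.ω) • h₂ +
    (th P g * theta4 s P.ω * theta4 (x - P.η / 2 - g) P.ω) • h₁ +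
    (th P g * theta1 s P.ω * theta1 (x - P.η / 2 - g) P.ω) • h₄ +
    (th P g * theta2 s P.ω * theta2 (x - P.η / 2 - g) P.ω) • h₃ -
    (theta3 s P.ω * e₃) • (U 0 1 - U 1 0) - (theta4 s P.ω * e₄) • (U 0 1 + U 1 0) -
    (theta1 s P.ω * e₁) • (U 0 0 + U 1 1) - (theta2 s P.ω * e₂) • (U 0 0 - U 1 1)

end GaugeParity

end Gauge

end EightVertex

end

noncomputable section

namespace EightVertex

section Final

variable {N : ℕ} (P : Params N)

/-! ### Parity relations of the gauged generators -/

section GeneratorParity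

/-- This accounts for θ₄(2x-η) in `rfun`: under x → -x it trades p(x) for θ(2x-η), so that only θ
appears in the parity relations. -/
lemma theta4_mul_th_eq (hω : 0 < P.ω.im) (x : ℂ) :
    theta4 (2 * x + P.η) (2 * P.ω) * th P (2 * x - P.η) =
      pfun P x * theta4 (2 * x - P.η) (2 * P.ω) := by
  have h₂ := theta2_zero_ne_zero hω
  have e := theta1_mul_theta4_double P hω (2 * x - P.η)
  rw [pfun]
  field_simp
  linear_combination -theta4 (2 * x + P.η) (2 * P.ω) * e

lemma theta4_ne_zero_of_rfun_neg {x : ℂ} (h : rfun P (-x) ≠ 0) :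
    theta4 (2 * x + P.η) (2 * P.ω) ≠ 0 := by
  have := left_ne_zero_of_mul h
  rwa [show 2 * -x - P.η = -(2 * x + P.η) by ring, theta4_neg] at this

variable (hω : 0 < P.ω.im) (hζ : theta1 P.ζ (2 * P.ω) ≠ 0) {x β : ℂ} (hx : rfun P x ≠ 0)
  (hx' : rfun P (-x) ≠ 0)
include hω hζ hx hx'

lemma genB_neg (h₁ : th P (2 * x - P.η) ≠ 0) (hβ : th P (β * P.η) ≠ 0) :
    genB P (-x) β = -((th P (2 * x + P.η) / th P (2 * x - P.η)) • genB P x β) := by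
  have t₁ := left_ne_zero_of_mul hx
  have t₂ := theta4_ne_zero_of_rfun_neg P hx'
  have h := pfun_smul_gaugeForm P hω (parityRelation_Uminus P hω hζ t₁ t₂)
    ((P.α - β + 1) * P.η)
  have rel := theta4_mul_th_eq P hω x
  have hp : theta4 (2 * x + P.η) (2 * P.ω) / (2 * th P (β * P.η)) =
      theta4 (2 * x - P.η) (2 * P.ω) / (2 * th P (β * P.η) * th P (2 * x - P.η)) * pfun P x := by
    generalize th P (β * P.η) = c at hβ ⊢
    field_simp
    linear_combination rel
  rw [genB_eq P hω hx, genB_eq P hω hx', show -x - P.η / 2 = -(x + P.η / 2) by ring,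
    show 2 * -x - P.η = -(2 * x + P.η) by ring, theta4_neg, hp, neg_smul, mul_smul, h]
  generalize th P (β * P.η) = c at hβ ⊢
  match_scalars
  field_simp

lemma genC_neg (h₁ : th P (2 * x - P.η) ≠ 0) (hβ : th P ((β - 2) * P.η) ≠ 0) :
    genC P (-x) β = -((th P (2 * x + P.η) / th P (2 * x - P.η)) • genC P x β) := by
  have t₁ := left_ne_zero_of_mul hx
  have t₂ := theta4_ne_zero_of_rfun_neg P hx'
  have h := pfun_smul_gaugeForm P hω (parityRelation_Uminus P hω hζ t₁ t₂)
    ((P.α + β - 1) * P.η)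
  have rel := theta4_mul_th_eq P hω x
  have hp : theta4 (2 * x + P.η) (2 * P.ω) / (2 * th P ((β - 2) * P.η)) =
      theta4 (2 * x - P.η) (2 * P.ω) / (2 * th P ((β - 2) * P.η) * th P (2 * x - P.η)) *
        pfun P x := by
    generalize th P ((β - 2) * P.η) = c at hβ ⊢
    field_simp
    linear_combination rel
  rw [genC_eq P hω hx, genC_eq P hω hx', show -x - P.η / 2 = -(x + P.η / 2) by ring,
    show 2 * -x - P.η = -(2 * x + P.η) by ring, theta4_neg, hp, mul_smul, h]
  generalize th P ((β - 2) * P.η) = c at hβ ⊢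
  match_scalars
  field_simp

variable (h₀ : th P (2 * x) ≠ 0) (hβ' : th P ((β - 2) * P.η) ≠ 0) (hβ : th P (β * P.η) ≠ 0)
include h₀ hβ' hβ

/-- Take g = (β-1)η, so that d = -(x-η/2-g) belongs to 𝒟₋(-x), and solve for the term of 𝒜₋(x),
whose coefficient contains θ(g+η) = θ(βη). The converse relation uses g = -(β-1)η. -/
lemma genA_eq_genD : genA P x β =
    -((th P P.η * th P (2 * x - (β - 1) * P.η) / (th P (2 * x) * th P ((β - 2) * P.η))) •
      genD P x β) +
    (th P (2 * x - P.η) * th P ((β - 1) * P.η) / (th P (2 * x) * th P ((β - 2) * P.η))) •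
      genD P (-x) β := by
  have t₁ := left_ne_zero_of_mul hx
  have t₂ := theta4_ne_zero_of_rfun_neg P hx'
  have h := th_mul_pfun_smul_gaugeForm P hω (parityRelation_Uminus P hω hζ t₁ t₂)
    ((P.α + 1) * P.η) ((β - 1) * P.η)
  have rel := theta4_mul_th_eq P hω x
  rw [show (β - 1) * P.η + P.η = β * P.η by ring] at h
  rw [genA_eq P hω hx, genD_eq P hω hx, genD_eq P hω hx',
    show -x + P.η / 2 + (β - 1) * P.η = -(x - P.η / 2 - (β - 1) * P.η) by ring,
    show 2 * -x - P.η = -(2 * x + P.η) by ring, theta4_neg]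
  generalize th P (2 * x - (β - 1) * P.η) = e₁ at *
  generalize th P ((β - 2) * P.η) = c₂ at *
  generalize th P (β * P.η) = c at *
  generalize th P ((β - 1) * P.η) = c₁ at *
  generalize gaugeForm P _ (x + P.η / 2 - (β - 1) * P.η) _ = GA at *
  generalize gaugeForm P _ (x + P.η / 2 + (β - 1) * P.η) _ = GD at *
  have hp : th P (2 * x - P.η) * c₁ / (th P (2 * x) * c₂) *
      (theta4 (2 * x + P.η) (2 * P.ω) / (2 * c)) =
      theta4 (2 * x - P.η) (2 * P.ω) / (2 * th P (2 * x) * c₂ * c) * (c₁ * pfun P x) := by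
    field_simp
    linear_combination c₁ * rel
  rw [smul_smul (th P (2 * x - P.η) * c₁ / (th P (2 * x) * c₂)), hp, mul_smul, h]
  match_scalars <;> field_simp
  ring

lemma genD_eq_genA : genD P x β =
    (th P P.η * th P (2 * x + (β - 1) * P.η) / (th P (2 * x) * th P (β * P.η))) •
      genA P x β +
    (th P (2 * x - P.η) * th P ((β - 1) * P.η) / (th P (2 * x) * th P (β * P.η))) •
      genA P (-x) β := by
  have t₁ := left_ne_zero_of_mul hx
  have t₂ := theta4_ne_zero_of_rfun_neg P hx'
  have h := th_mul_pfun_smul_gaugeForm P hω (parityRelation_Uminus P hω hζ t₁ t₂)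
    ((P.α + 1) * P.η) (-((β - 1) * P.η))
  have rel := theta4_mul_th_eq P hω x
  have th_neg (u : ℂ) : th P (-u) = -th P u := theta1_neg u _
  rw [show -((β - 1) * P.η) + P.η = -((β - 2) * P.η) by ring, th_neg, th_neg, sub_neg_eq_add,
    sub_neg_eq_add, sub_neg_eq_add, ← sub_eq_add_neg] at h
  rw [genD_eq P hω hx, genA_eq P hω hx, genA_eq P hω hx',
    show -x + P.η / 2 - (β - 1) * P.η = -(x - P.η / 2 + (β - 1) * P.η) by ring,
    show 2 * -x - P.η = -(2 * x + P.η) by ring, theta4_neg]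
  generalize th P (2 * x + (β - 1) * P.η) = e₁ at *
  generalize th P ((β - 2) * P.η) = c₂ at *
  generalize th P (β * P.η) = c at *
  generalize th P ((β - 1) * P.η) = c₁ at *
  generalize gaugeForm P _ (x + P.η / 2 - (β - 1) * P.η) _ = GA at *
  generalize gaugeForm P _ (x + P.η / 2 + (β - 1) * P.η) _ = GD at *
  have hp : th P (2 * x - P.η) * c₁ / (th P (2 * x) * c) *
      (-(theta4 (2 * x + P.η) (2 * P.ω) / (2 * c₂))) =
      theta4 (2 * x - P.η) (2 * P.ω) / (2 * th P (2 * x) * c₂ * c) * (-c₁ * pfun P x) := by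
    field_simp
    linear_combination -c₁ * rel
  rw [smul_smul (th P (2 * x - P.η) * c₁ / (th P (2 * x) * c)), hp, mul_smul, h]
  match_scalars <;> field_simp
  ring

end GeneratorParity

/-! ### The quantum determinant -/

section QuantumDeterminant

/-- The scalar by which `𝒰₋(x + η/2) 𝒰₋(η/2 - x)` acts. -/
def inversionScalar (x : ℂ) : ℂ := Kunit P x * qdetM P x * qdetM P (-x)

lemma inversionScalar_neg (x : ℂ) : inversionScalar P (-x) = inversionScalar P x := by
  rw [inversionScalar, inversionScalar, Kunit_neg, neg_neg]; ring

variable (hω : 0 < P.ω.im)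
include hω

/-- The bracket defining the quantum determinant is the (0,0) entry of 𝒰₋(x+η/2) 𝒰₋(η/2-x). -/
lemma qdetU_eq_smul (x : ℂ) :
    qdetU P x = (pfun P (x - P.η / 2) * inversionScalar P x) • 1 := by
  have h := congrFun (congrFun (Uminus_mul_Uminus P hω x) 0) 0
  rw [Matrix.mul_apply, Fin.sum_univ_two] at h
  rw [qdetU, h, Matrix.smul_apply, Matrix.one_apply_eq, smul_smul, inversionScalar]

lemma qdetU_eq (x : ℂ) :
    qdetU P x = (qdetK P x * qdetM P x * qdetM P (-x)) • (1 : Op N) := by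
  rw [qdetU_eq_smul P hω, inversionScalar, qdetK, Kunit]
  have k₁ : Kminus P (x + P.η / 2) = Kmat P x := by rw [Kminus, add_sub_cancel_right]
  have k₂ : Kminus P (P.η / 2 - x) = Kmat P (-x) := by rw [Kminus]; congr 1; ring
  rw [k₁, k₂]
  congr 1; ring

/-- The product formula for θ₁θ₁ gives det G̃ = -θ(x+(α+1)η) θ(bη), and `GtilInv` is the adjugate
divided by it. -/
lemma Gtil_mul_GtilInv {x b : ℂ} (hx : th P (x + (P.α + 1) * P.η) ≠ 0)
    (hb : th P (b * P.η) ≠ 0) : Gtil P x b * GtilInv P x b = 1 := by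
  have e := theta1_mul_theta1 (x + (P.α + 1) * P.η) (b * P.η) hω
  rw [show x + (P.α + 1) * P.η + b * P.η = x + (P.α + (b + 1)) * P.η by ring,
    show x + (P.α + 1) * P.η - b * P.η = x + (P.α - (b - 1)) * P.η by ring] at e
  change th P _ * th P _ = _ at e
  ext i j
  rw [Matrix.mul_apply, Fin.sum_univ_two]
  simp only [GtilInv, Gtil, Ytil, Xtil, Xvec, Yvec, Matrix.of_apply, Matrix.transpose_apply,
    Matrix.cons_val_zero, Matrix.cons_val_one, Pi.smul_apply, smul_eq_mul,
    show (1 + (b - 1)) * P.η = b * P.η by ring, show (b + 1 - 1) * P.η = b * P.η by ring]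
  generalize theta2 (x + (P.α + (b + 1)) * P.η) (2 * P.ω) = p₂ at *
  generalize theta3 (x + (P.α + (b + 1)) * P.η) (2 * P.ω) = p₃ at *
  generalize theta2 (x + (P.α - (b - 1)) * P.η) (2 * P.ω) = q₂ at *
  generalize theta3 (x + (P.α - (b - 1)) * P.η) (2 * P.ω) = q₃ at *
  generalize th P (x + (P.α + 1) * P.η) = c at *
  generalize th P (b * P.η) = c' at *
  fin_cases i <;> fin_cases j <;> simp <;> field_simp <;>
    first | linear_combination e | linear_combination -e | ring1

lemma GtilInv_mul_Gtil {x b : ℂ} (hx : th P (x + (P.α + 1) * P.η) ≠ 0)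
    (hb : th P (b * P.η) ≠ 0) : GtilInv P x b * Gtil P x b = 1 :=
  mul_eq_one_comm.1 (Gtil_mul_GtilInv P hω hx hb)

omit hω in
lemma th_ne_zero_of_rfun {x : ℂ} (h : rfun P (x + P.η / 2) ≠ 0) :
    th P (x + (P.α + 1) * P.η) ≠ 0 := by
  have := right_ne_zero_of_mul h
  rwa [show x + P.η / 2 + (P.α + 1 / 2) * P.η = x + (P.α + 1) * P.η by ring] at this

lemma Ugauge_mul_Ugauge {x b : ℂ} (hx : rfun P (x + P.η / 2) ≠ 0)
    (hx' : rfun P (-x + P.η / 2) ≠ 0) (hb : th P (b * P.η) ≠ 0) :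
    Ugauge P (x + P.η / 2) b * Ugauge P (P.η / 2 - x) b = inversionScalar P x • 1 := by
  have g₁ := Gtil_mul_GtilInv P hω (th_ne_zero_of_rfun P hx') hb
  have g₂ := GtilInv_mul_Gtil P hω (th_ne_zero_of_rfun P hx) hb
  rw [Ugauge, Ugauge, show x + P.η / 2 - P.η / 2 = x by ring,
    show P.η / 2 - (x + P.η / 2) = -x by ring, show P.η / 2 - x - P.η / 2 = -x by ring,
    show P.η / 2 - (P.η / 2 - x) = x by ring]
  calc _ = scalarMat (GtilInv P x b) * (Uminus P (x + P.η / 2) *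
        (scalarMat (Gtil P (-x) b) * scalarMat (GtilInv P (-x) b)) * Uminus P (P.η / 2 - x)) *
          scalarMat (Gtil P x b) := by simp only [mul_assoc]
    _ = _ := by
      rw [scalarMat_mul_scalarMat, g₁, scalarMat_one, mul_one, Uminus_mul_Uminus P hω,
        mul_smul_comm, smul_mul_assoc, mul_one, scalarMat_mul_scalarMat, g₂, scalarMat_one,
        inversionScalar]

lemma Ugauge_mul_Ugauge' {x b : ℂ} (hx : rfun P (x + P.η / 2) ≠ 0)
    (hx' : rfun P (-x + P.η / 2) ≠ 0) (hb : th P (b * P.η) ≠ 0) :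
    Ugauge P (P.η / 2 - x) b * Ugauge P (x + P.η / 2) b = inversionScalar P x • 1 := by
  have := Ugauge_mul_Ugauge P hω (x := -x) hx' (by rwa [neg_neg]) hb
  rwa [inversionScalar_neg, sub_neg_eq_add, neg_add_eq_sub, add_comm (P.η / 2)] at this

omit hω in
lemma onChain_smul_one (c : ℂ) : onChain (c • (1 : Op N)) = c • 1 := by
  ext1 i j
  simp only [onChain, Matrix.diagonal_apply, Matrix.smul_apply, Matrix.one_apply, smul_ite,
    smul_zero]

/-- The quantum determinant is p times the inversion scalar; if it is invertible both factors are
nonzero, and p cancels. -/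
lemma inverse_Ugauge {x b : ℂ} (hx : rfun P (x + P.η / 2) ≠ 0)
    (hx' : rfun P (-x + P.η / 2) ≠ 0) (hb : th P (b * P.η) ≠ 0) (hU : IsUnit (qdetU P x)) :
    IsUnit (Ugauge P (x + P.η / 2) b) ∧ Ring.inverse (Ugauge P (x + P.η / 2) b) =
      onChain (Ring.inverse (qdetU P x)) *
        (pfun P (x - P.η / 2) • Ugauge P (P.η / 2 - x) b) := by
  have h₁ := Ugauge_mul_Ugauge P hω hx hx' hb
  have h₂ := Ugauge_mul_Ugauge' P hω hx hx' hb
  have hq := qdetU_eq_smul P hω x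
  have hc : pfun P (x - P.η / 2) * inversionScalar P x ≠ 0 := by
    intro h0
    rw [hq, h0, zero_smul] at hU
    exact not_isUnit_zero hU
  have hinv : Ring.inverse (qdetU P x) =
      (pfun P (x - P.η / 2) * inversionScalar P x)⁻¹ • 1 := by
    rw [hq]
    exact Ring.inverse_unit ⟨_, (pfun P (x - P.η / 2) * inversionScalar P x)⁻¹ • (1 : Op N),
      by rw [smul_mul_smul_comm, mul_inv_cancel₀ hc, one_mul, one_smul],
      by rw [smul_mul_smul_comm, inv_mul_cancel₀ hc, one_mul, one_smul]⟩
  have hp := left_ne_zero_of_mul hc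
  have hv := right_ne_zero_of_mul hc
  have e : onChain (Ring.inverse (qdetU P x)) *
      (pfun P (x - P.η / 2) • Ugauge P (P.η / 2 - x) b) =
        (inversionScalar P x)⁻¹ • Ugauge P (P.η / 2 - x) b := by
    rw [hinv, onChain_smul_one, smul_mul_assoc, one_mul, smul_smul, mul_inv, mul_assoc,
      mul_comm, mul_assoc, mul_inv_cancel₀ hp, mul_one]
  rw [e]
  let u : (AuxOp N)ˣ := ⟨Ugauge P (x + P.η / 2) b,
    (inversionScalar P x)⁻¹ • Ugauge P (P.η / 2 - x) b,
    by rw [mul_smul_comm, h₁, smul_smul, inv_mul_cancel₀ hv, one_smul],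
    by rw [smul_mul_assoc, h₂, smul_smul, inv_mul_cancel₀ hv, one_smul]⟩
  exact ⟨u.isUnit, Ring.inverse_unit u⟩

/-- At x-η/2 the two gauge factors are those of 𝖴₋(η/2-x|b). The parity relation there needs θ₄(2x)
≠ 0, which is part of `hx`, and θ₄(2x-2η) ≠ 0. -/
lemma UgaugeTilde_eq (hζ : theta1 P.ζ (2 * P.ω) ≠ 0) {x b : ℂ}
    (hx : rfun P (x + P.η / 2) ≠ 0) (hη : th P P.η ≠ 0)
    (h₄ : theta4 (2 * x - 2 * P.η) (2 * P.ω) ≠ 0) :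
    UgaugeTilde P (x - P.η / 2) b = pfun P (x - P.η / 2) • Ugauge P (P.η / 2 - x) b := by
  have t := left_ne_zero_of_mul hx
  rw [show 2 * (x + P.η / 2) - P.η = 2 * x by ring] at t
  have h := Utilde_eq P hω hη (parityRelation_Uminus P hω hζ (x := x - P.η / 2)
    (by rwa [show 2 * (x - P.η / 2) - P.η = 2 * x - 2 * P.η by ring])
    (by rwa [show 2 * (x - P.η / 2) + P.η = 2 * x by ring]))
  rw [UgaugeTilde, Ugauge, h, neg_sub, show P.η / 2 + (x - P.η / 2) = x by ring,
    show P.η / 2 - (P.η / 2 - x) = x by ring, mul_smul_comm, smul_mul_assoc]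

lemma gen_mul_gen {x b : ℂ} (hx : rfun P (x + P.η / 2) ≠ 0)
    (hx' : rfun P (-x + P.η / 2) ≠ 0) (hb : th P (b * P.η) ≠ 0) :
    genA P (x + P.η / 2) (b + 2) * genA P (P.η / 2 - x) (b + 2) +
        genB P (x + P.η / 2) b * genC P (P.η / 2 - x) (b + 2) =
      (rfun P (x + P.η / 2) * rfun P (-x + P.η / 2) * inversionScalar P x) • 1 ∧
    genD P (x + P.η / 2) b * genD P (P.η / 2 - x) b +
        genC P (x + P.η / 2) (b + 2) * genB P (P.η / 2 - x) b =
      (rfun P (x + P.η / 2) * rfun P (-x + P.η / 2) * inversionScalar P x) • 1 := by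
  have h := Ugauge_mul_Ugauge P hω hx hx' hb
  have h₁ := congrFun (congrFun h 0) 0
  have h₂ := congrFun (congrFun h 1) 1
  rw [Matrix.mul_apply, Fin.sum_univ_two, Matrix.smul_apply, Matrix.one_apply_eq] at h₁ h₂
  simp only [genA, genB, genC, genD, add_sub_cancel_right, smul_mul_smul_comm, ← smul_add]
  rw [← neg_add_eq_sub] at *
  constructor
  · rw [h₁, smul_smul]
  · rw [add_comm (Ugauge P _ b 1 1 * _), h₂, smul_smul]

/-- The sign ε = -1 is the case ε = 1 at -x: the inversion scalar is even, and so is the product of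
the two factors `rfun`. -/
lemma qdetU_gen {x b ε : ℂ} (hε : ε = 1 ∨ ε = -1) (hx : rfun P (x + P.η / 2) ≠ 0)
    (hx' : rfun P (-x + P.η / 2) ≠ 0) (hb : th P (b * P.η) ≠ 0)
    (hp : pfun P (x - P.η / 2) ≠ 0) :
    (rfun P (x + P.η / 2) * rfun P (-x + P.η / 2) / pfun P (x - P.η / 2)) • qdetU P x =
        genA P (ε * x + P.η / 2) (b + 2) * genA P (P.η / 2 - ε * x) (b + 2) +
          genB P (ε * x + P.η / 2) b * genC P (P.η / 2 - ε * x) (b + 2) ∧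
    (rfun P (x + P.η / 2) * rfun P (-x + P.η / 2) / pfun P (x - P.η / 2)) • qdetU P x =
        genD P (ε * x + P.η / 2) b * genD P (P.η / 2 - ε * x) b +
          genC P (ε * x + P.η / 2) (b + 2) * genB P (P.η / 2 - ε * x) b := by
  have hq : (rfun P (x + P.η / 2) * rfun P (-x + P.η / 2) / pfun P (x - P.η / 2)) • qdetU P x =
      (rfun P (x + P.η / 2) * rfun P (-x + P.η / 2) * inversionScalar P x) • 1 := by
    rw [qdetU_eq_smul P hω, smul_smul]
    congr 1
    generalize pfun P (x - P.η / 2) = p at hp ⊢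
    field_simp
  rw [hq]
  rcases hε with rfl | rfl
  · rw [one_mul]
    have h := gen_mul_gen P hω hx hx' hb
    exact ⟨h.1.symm, h.2.symm⟩
  · rw [neg_one_mul]
    have h := gen_mul_gen P hω (x := -x) hx' (by rwa [neg_neg]) hb
    rw [inversionScalar_neg, neg_neg, mul_comm (rfun P (-x + _))] at h
    exact ⟨h.1.symm, h.2.symm⟩

end QuantumDeterminant

end Final

end EightVertex

end

theorem mainTheorem9 {N : ℕ} (P : EightVertex.Params N) (hω : 0 < P.ω.im)
    (hζ : EightVertex.theta1 P.ζ (2 * P.ω) ≠ 0) :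
    -- interrelated parity relations of `𝒜₋` and `𝒟₋`
    (∀ x β : ℂ,
      EightVertex.rfun P x ≠ 0 → EightVertex.rfun P (-x) ≠ 0 →
      EightVertex.th P (2 * x) ≠ 0 →
      EightVertex.th P ((β - 2) * P.η) ≠ 0 → EightVertex.th P (β * P.η) ≠ 0 →
      EightVertex.genA P x β =
          -((EightVertex.th P P.η * EightVertex.th P (2 * x - (β - 1) * P.η) /
              (EightVertex.th P (2 * x) * EightVertex.th P ((β - 2) * P.η))) •
            EightVertex.genD P x β) +
          (EightVertex.th P (2 * x - P.η) * EightVertex.th P ((β - 1) * P.η) /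
              (EightVertex.th P (2 * x) * EightVertex.th P ((β - 2) * P.η))) •
            EightVertex.genD P (-x) β ∧
      EightVertex.genD P x β =
          (EightVertex.th P P.η * EightVertex.th P (2 * x + (β - 1) * P.η) /
              (EightVertex.th P (2 * x) * EightVertex.th P (β * P.η))) •
            EightVertex.genA P x β +
          (EightVertex.th P (2 * x - P.η) * EightVertex.th P ((β - 1) * P.η) /
              (EightVertex.th P (2 * x) * EightVertex.th P (β * P.η))) •
            EightVertex.genA P (-x) β) ∧
    -- parity relation of `ℬ₋`
    (∀ x β : ℂ,
      EightVertex.rfun P x ≠ 0 → EightVertex.rfun P (-x) ≠ 0 →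
      EightVertex.th P (2 * x - P.η) ≠ 0 → EightVertex.th P (β * P.η) ≠ 0 →
      EightVertex.genB P (-x) β =
        -((EightVertex.th P (2 * x + P.η) / EightVertex.th P (2 * x - P.η)) •
          EightVertex.genB P x β)) ∧
    -- parity relation of `𝒞₋`
    (∀ x β : ℂ,
      EightVertex.rfun P x ≠ 0 → EightVertex.rfun P (-x) ≠ 0 →
      EightVertex.th P (2 * x - P.η) ≠ 0 → EightVertex.th P ((β - 2) * P.η) ≠ 0 →
      EightVertex.genC P (-x) β =
        -((EightVertex.th P (2 * x + P.η) / EightVertex.th P (2 * x - P.η)) •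
          EightVertex.genC P x β)) ∧
    -- the quantum determinant is a scalar, with the stated value
    (∀ x : ℂ, EightVertex.theta4 (2 * x) (2 * P.ω) ≠ 0 →
      EightVertex.qdetU P x =
        (EightVertex.qdetK P x * EightVertex.qdetM P x * EightVertex.qdetM P (-x)) •
          (1 : EightVertex.Op N)) ∧
    -- inversion formula
    (∀ x β : ℂ,
      EightVertex.rfun P (x + P.η / 2) ≠ 0 → EightVertex.rfun P (-x + P.η / 2) ≠ 0 →
      EightVertex.th P (β * P.η) ≠ 0 →
      (EightVertex.Ugauge P (x + P.η / 2) β *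
          (EightVertex.pfun P (x - P.η / 2) • EightVertex.Ugauge P (P.η / 2 - x) β) =
        EightVertex.onChain (EightVertex.qdetU P x) ∧
      (EightVertex.pfun P (x - P.η / 2) • EightVertex.Ugauge P (P.η / 2 - x) β) *
          EightVertex.Ugauge P (x + P.η / 2) β =
        EightVertex.onChain (EightVertex.qdetU P x)) ∧
      (IsUnit (EightVertex.qdetU P x) →
        IsUnit (EightVertex.Ugauge P (x + P.η / 2) β) ∧
        Ring.inverse (EightVertex.Ugauge P (x + P.η / 2) β) =
          EightVertex.onChain (Ring.inverse (EightVertex.qdetU P x)) *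
            (EightVertex.pfun P (x - P.η / 2) • EightVertex.Ugauge P (P.η / 2 - x) β)) ∧
      (EightVertex.th P P.η ≠ 0 → EightVertex.theta4 (2 * x - 2 * P.η) (2 * P.ω) ≠ 0 →
        EightVertex.UgaugeTilde P (x - P.η / 2) β =
          EightVertex.pfun P (x - P.η / 2) • EightVertex.Ugauge P (P.η / 2 - x) β ∧
        (IsUnit (EightVertex.qdetU P x) →
          Ring.inverse (EightVertex.Ugauge P (x + P.η / 2) β) =
            EightVertex.onChain (Ring.inverse (EightVertex.qdetU P x)) *
              EightVertex.UgaugeTilde P (x - P.η / 2) β))) ∧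
    -- the quantum determinant through the gauged generators
    (∀ x β ε : ℂ, ε = 1 ∨ ε = -1 →
      EightVertex.rfun P (x + P.η / 2) ≠ 0 → EightVertex.rfun P (-x + P.η / 2) ≠ 0 →
      EightVertex.th P (β * P.η) ≠ 0 → EightVertex.pfun P (x - P.η / 2) ≠ 0 →
      (EightVertex.rfun P (x + P.η / 2) * EightVertex.rfun P (-x + P.η / 2) /
          EightVertex.pfun P (x - P.η / 2)) • EightVertex.qdetU P x =
        EightVertex.genA P (ε * x + P.η / 2) (β + 2) *
            EightVertex.genA P (P.η / 2 - ε * x) (β + 2) +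
          EightVertex.genB P (ε * x + P.η / 2) β *
            EightVertex.genC P (P.η / 2 - ε * x) (β + 2) ∧
      (EightVertex.rfun P (x + P.η / 2) * EightVertex.rfun P (-x + P.η / 2) /
          EightVertex.pfun P (x - P.η / 2)) • EightVertex.qdetU P x =
        EightVertex.genD P (ε * x + P.η / 2) β *
            EightVertex.genD P (P.η / 2 - ε * x) β +
          EightVertex.genC P (ε * x + P.η / 2) (β + 2) *
            EightVertex.genB P (P.η / 2 - ε * x) β) := by
  refine ⟨fun x β hx hx' h₀ hβ' hβ => ⟨?_, ?_⟩, fun x β hx hx' h₁ hβ => ?_,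
    fun x β hx hx' h₁ hβ => ?_, fun x _ => ?_, fun x β hx hx' hβ => ⟨⟨?_, ?_⟩, fun hU => ?_,
    fun hη h₄ => ⟨?_, fun hU => ?_⟩⟩, fun x β ε hε hx hx' hβ hp => ?_⟩
  · exact EightVertex.genA_eq_genD P hω hζ hx hx' h₀ hβ' hβ
  · exact EightVertex.genD_eq_genA P hω hζ hx hx' h₀ hβ' hβ
  · exact EightVertex.genB_neg P hω hζ hx hx' h₁ hβ
  · exact EightVertex.genC_neg P hω hζ hx hx' h₁ hβ
  · exact EightVertex.qdetU_eq P hω x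
  · rw [mul_smul_comm, EightVertex.Ugauge_mul_Ugauge P hω hx hx' hβ,
      EightVertex.qdetU_eq_smul P hω, EightVertex.onChain_smul_one, smul_smul]
  · rw [smul_mul_assoc, EightVertex.Ugauge_mul_Ugauge' P hω hx hx' hβ,
      EightVertex.qdetU_eq_smul P hω, EightVertex.onChain_smul_one, smul_smul]
  · exact EightVertex.inverse_Ugauge P hω hx hx' hβ hU
  · exact EightVertex.UgaugeTilde_eq P hω hζ hx hη h₄
  · rw [EightVertex.UgaugeTilde_eq P hω hζ hx hη h₄]
    exact (EightVertex.inverse_Ugauge P hω hx hx' hβ hU).2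
  · exact EightVertex.qdetU_gen P hω hε hx hx' hβ hp
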